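/- Let $M,K\in\mathbb{R}^{n\times n}$ be symmetric positive definite and let $D_{ij},R_{ij}\in\mathbb{R}^{n\times n}$ ($i,j=1,\dots,q$) be symmetric positive semidefinite with $D_{ij}=D_{ji}$, $R_{ij}=R_{ji}$, $D_{ii}=R_{ii}=0$, and $R_{ij}\ne 0$ for at least one pair $(i,j)$. For $\varepsilon>0$ consider the array $$M\ddot x_i+Kx_i+\sum_{j=1}^q D_{ij}(\dot x_i-\dot x_j)+\varepsilon\sum_{j=1}^q R_{ij}(x_i-x_j)=0,\qquad i=1,\dots,q, \qquad (*)$$ with $x_i(t)\in\mathbb{R}^n$. It synchronizes if $\|x_i(t)-x_j(t)\|\to0$ as $t\to\infty$ for all $i,j$ and every solution. Suppose that the eigenvalues $\sigma_1,\dots,\sigma_n$ of $P=M^{-1/2}KM^{-1/2}$ are distinct, and let $v_1,\dots,v_n\in\mathbb{R}^n$ be corresponding unit eigenvectors. For weights $W_{ij}$ with $W_{ii}=0$, let $\mathrm{lap}(W_{ij})$ be the $q\times q$ block matrix with diagonal blocks $\sum_jW_{ij}$ and off-diagonal blocks $-W_{ij}$. Put $L_d=\mathrm{lap}(M^{-1/2}D_{ij}M^{-1/2})$,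 $L_r=\mathrm{lap}(M^{-1/2}R_{ij}M^{-1/2})$, and $$G_{k\ell}=[I_q\otimes v_k^T]L_d[I_q\otimes v_\ell],\qquad B_{k\ell}=[I_q\otimes v_k^T]L_r[I_q\otimes v_\ell]\qquad(k,\ell=1,\dots,n),$$ and let $G=(G_{k\ell})$, $B=(B_{k\ell})$ be the $nq\times nq$ matrices with these blocks. For a square complex matrix $X$, let $\lambda_k(X)$ be its $k$th eigenvalue, counted with algebraic multiplicity, in nondecreasing order of real part; $\|\cdot\|$ is the (induced) $2$-norm. Define $$\bar\sigma=\tfrac12\min_{k\ne\ell}|\sigma_k-\sigma_\ell|,\qquad \bar\mu=\tfrac12\min_k\ \min_{\lambda\neq\lambda'}|\lambda-\lambda'|,$$ where the inner minimum is over distinct eigenvalues $\lambda,\lambda'$ of $B_{kk}$ (and is $+\infty$ if there is only one), and $$\bar\gamma=\Big[\min_k\min_{w\in\mathcal C_k}w^*G_{kk}w\Big]^{1/2},\qquad \mathcal C_k=\Big\{w\in\mathbb{C}^q:\|w\|=1,\ B_{kk}w=\mu w\text{ for some }\mu\in\mathbb{R},\ \sum_i w_i=0\Big\}.$$ Theorem.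 Suppose $\mathrm{Re}\,\lambda_2(G_{kk}+jB_{kk})>0$ for all $k=1,\dots,n$, where $j=\sqrt{-1}$. Then there exists $r>0$ such that the array $(*)$ synchronizes for all $\varepsilon\in(0,r)$. In particular, if $n\ge2$, one can choose $$r=\frac{\bar\gamma\,\bar\sigma\,\bar\mu}{\big(\sqrt{\|G\|}+2\bar\gamma\big)\sqrt{n-1}\,\|B\|\,(\bar\mu+\|B\|)},$$ which is positive; if $n=1$, one can choose $r=+\infty$, i.e. $(*)$ synchronizes for every $\varepsilon>0$. -/

import Mathlib

open Matrix Filter Topology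

noncomputable section

namespace OscArray

/-- `x = (x₁, …, x_q)` solves, on the time interval `[0, ∞)`,
`M ẍᵢ + K xᵢ + ∑ⱼ Dᵢⱼ (ẋᵢ - ẋⱼ) + ∑ⱼ Rᵢⱼ (xᵢ - xⱼ) = 0` for all `i`
(`v` and `a` are the first and the second time derivative of `x`). -/
def IsSolution {q n : ℕ} (M K : Matrix (Fin n) (Fin n) ℝ)
    (D R : Fin q → Fin q → Matrix (Fin n) (Fin n) ℝ)
    (x : Fin q → ℝ → EuclideanSpace ℝ (Fin n)) : Prop :=
  ∃ v a : Fin q → ℝ → EuclideanSpace ℝ (Fin n),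
    ∀ i, ∀ t ∈ Set.Ici (0 : ℝ),
      HasDerivWithinAt (x i) (v i t) (Set.Ici 0) t ∧
      HasDerivWithinAt (v i) (a i t) (Set.Ici 0) t ∧
      M *ᵥ (a i t).ofLp + K *ᵥ (x i t).ofLp
        + ∑ j, D i j *ᵥ (v i t - v j t).ofLp
        + ∑ j, R i j *ᵥ (x i t - x j t).ofLp = 0

/-- The array synchronizes: `‖xᵢ(t) - xⱼ(t)‖ → 0` as `t → ∞` for all `i, j`
and for every solution, that is, for all initial conditions. -/
def Synchronizes {q n : ℕ} (M K : Matrix (Fin n) (Fin n) ℝ)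
    (D R : Fin q → Fin q → Matrix (Fin n) (Fin n) ℝ) : Prop :=
  ∀ x : Fin q → ℝ → EuclideanSpace ℝ (Fin n), IsSolution M K D R x →
    ∀ i j, Tendsto (fun t => ‖x i t - x j t‖) atTop (𝓝 0)

/-- `M^{-1/2}`: the inverse of the positive semidefinite square root of `M`. -/
def invSqrt {n : ℕ} (M : Matrix (Fin n) (Fin n) ℝ) : Matrix (Fin n) (Fin n) ℝ :=
  open scoped MatrixOrder in (CFC.sqrt M)⁻¹

/-- `P = M^{-1/2} K M^{-1/2}`. -/
def normalizedStiffness {n : ℕ} (M K : Matrix (Fin n) (Fin n) ℝ) :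
    Matrix (Fin n) (Fin n) ℝ :=
  invSqrt M * K * invSqrt M

/-- The matrix-weighted Laplacian `lap (Wᵢⱼ)`: a `q × q` array of `n × n` blocks, with
diagonal blocks `∑ⱼ Wᵢⱼ` and off-diagonal blocks `-Wᵢⱼ` (for weights with `Wᵢᵢ = 0`). -/
def lap {q n : ℕ} (W : Fin q → Fin q → Matrix (Fin n) (Fin n) ℝ) :
    Matrix (Fin q × Fin n) (Fin q × Fin n) ℝ :=
  Matrix.of fun p r =>
    if p.1 = r.1 then (∑ j, W p.1 j) p.2 r.2 else -(W p.1 r.1 p.2 r.2)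

/-- `lap (M^{-1/2} Wᵢⱼ M^{-1/2})`: this is `L_d` for `W = D` and `L_r` for `W = R`. -/
def couplingLap {q n : ℕ} (M : Matrix (Fin n) (Fin n) ℝ)
    (W : Fin q → Fin q → Matrix (Fin n) (Fin n) ℝ) :
    Matrix (Fin q × Fin n) (Fin q × Fin n) ℝ :=
  lap fun i j => invSqrt M * W i j * invSqrt M

/-- The `qn × q` matrix `I_q ⊗ v` for a column vector `v ∈ ℝⁿ`. -/
def idKron (q : ℕ) {n : ℕ} (v : EuclideanSpace ℝ (Fin n)) :
    Matrix (Fin q × Fin n) (Fin q) ℝ :=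
  Matrix.of fun p j => (1 : Matrix (Fin q) (Fin q) ℝ) p.1 j * v p.2

/-- The `q × q` block `[I_q ⊗ v_kᵀ] L [I_q ⊗ v_l]`:
this is `G_kl` for `L = L_d` and `B_kl` for `L = L_r`. -/
def modalBlock {q n : ℕ} (L : Matrix (Fin q × Fin n) (Fin q × Fin n) ℝ)
    (v : Fin n → EuclideanSpace ℝ (Fin n)) (k l : Fin n) : Matrix (Fin q) (Fin q) ℝ :=
  (idKron q (v k))ᵀ * L * idKron q (v l)

/-- The `nq × nq` matrix with the blocks `modalBlock L v k l`:
this is `G` for `L = L_d` and `B` for `L = L_r`. -/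
def modalMatrix {q n : ℕ} (L : Matrix (Fin q × Fin n) (Fin q × Fin n) ℝ)
    (v : Fin n → EuclideanSpace ℝ (Fin n)) : Matrix (Fin n × Fin q) (Fin n × Fin q) ℝ :=
  Matrix.of fun p r => modalBlock L v p.1 r.1 p.2 r.2

/-- `Re λ_k(X)`: the `k`-th smallest (`k = 1, 2, …`) of the real parts of the eigenvalues of
the complex matrix `X`, counted with algebraic multiplicity
(a meaningful value for `1 ≤ k ≤` size of `X`). -/
def reEigenvalue {m : ℕ} (X : Matrix (Fin m) (Fin m) ℂ) (k : ℕ) : ℝ :=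
  ((X.charpoly.roots.map Complex.re).sort (· ≤ ·)).getD (k - 1) 0

/-- The complex matrix `G + jB`. -/
def admittance {q : ℕ} (G B : Matrix (Fin q) (Fin q) ℝ) : Matrix (Fin q) (Fin q) ℂ :=
  G.map Complex.ofReal + Complex.I • B.map Complex.ofReal

/-- The norm of a real matrix induced by the Euclidean norm of vectors. -/
def norm2 {ι : Type*} [Fintype ι] [DecidableEq ι] (X : Matrix ι ι ℝ) : ℝ :=
  ‖Matrix.toEuclideanCLM (𝕜 := ℝ) X‖

/-- `σ̄ = ½ min_{k ≠ l} |σ_k - σ_l|`. -/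
def sigmaBar {n : ℕ} (σ : Fin n → ℝ) : ℝ :=
  (1 / 2) * sInf {d | ∃ k l, k ≠ l ∧ d = |σ k - σ l|}

/-- `μ̄ = ½ min_k min |λ - λ'|`, the inner minimum over the pairs of distinct eigenvalues of
`B_k` (an index `k` whose `B_k` has only one eigenvalue does not contribute). -/
def muBar {q n : ℕ} (B : Fin n → Matrix (Fin q) (Fin q) ℝ) : ℝ :=
  (1 / 2) * sInf {d | ∃ k, ∃ a ∈ spectrum ℝ (B k), ∃ b ∈ spectrum ℝ (B k),
    a ≠ b ∧ d = |a - b|}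

/-- The unit vector `[1 1 ⋯ 1]ᵀ / √q`. -/
def oneVec (q : ℕ) : Fin q → ℂ := fun _ => ((1 / Real.sqrt q : ℝ) : ℂ)

/-- The set of the unit vectors `w ∈ ℂ^q` with `B w = μ w` for some real `μ`
and `1_qᵀ w = 0`. -/
def unitEigenvectors {q : ℕ} (B : Matrix (Fin q) (Fin q) ℝ) : Set (EuclideanSpace ℂ (Fin q)) :=
  {w | ‖w‖ = 1 ∧
    (∃ μ : ℝ, (B.map Complex.ofReal - (μ : ℂ) • (1 : Matrix (Fin q) (Fin q) ℂ)) *ᵥ w.ofLp = 0) ∧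
    oneVec q ⬝ᵥ w.ofLp = 0}

/-- `γ̄ = (min_k min_{w ∈ C_k} w* G_k w)^{1/2}`, where `C_k = unitEigenvectors (B k)`. -/
def gammaBar {q n : ℕ} (G B : Fin n → Matrix (Fin q) (Fin q) ℝ) : ℝ :=
  Real.sqrt (sInf {c | ∃ k, ∃ w ∈ unitEigenvectors (B k),
    c = (star w.ofLp ⬝ᵥ ((G k).map Complex.ofReal *ᵥ w.ofLp)).re})

/-- The explicit coupling bound
`γ̄ σ̄ μ̄ / ((√‖G‖ + 2 γ̄) √(n-1) ‖B‖ (μ̄ + ‖B‖))`, with `G`, `B` built from `L_d`, `L_r` and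
the eigenvectors `v`; meaningful for `n ≥ 2`. -/
def couplingBound {q n : ℕ} (Ld Lr : Matrix (Fin q × Fin n) (Fin q × Fin n) ℝ)
    (σ : Fin n → ℝ) (v : Fin n → EuclideanSpace ℝ (Fin n)) : ℝ :=
  let γ := gammaBar (fun k => modalBlock Ld v k k) (fun k => modalBlock Lr v k k)
  let s := sigmaBar σ
  let μ := muBar fun k => modalBlock Lr v k k
  let g := norm2 (modalMatrix Ld v)
  let b := norm2 (modalMatrix Lr v)
  γ * s * μ / ((Real.sqrt g + 2 * γ) * Real.sqrt ((n : ℝ) - 1) * b * (μ + b))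

end OscArray

end

namespace OscArray

/-! ### Asymptotic stability of linear differential equations -/

/-! In the modal coordinates z = Vᵀ M^{1/2} x the array reads z̈ + Σz + Gż + εBz = 0, where Σ acts
as σ_k on block k, and G, B are positive semidefinite and kill vectors that are constant on each
block. Synchronization means that z minus its block averages tends to 0. This centred part solves
the same equation, and there the oscillator is asymptotically stable unless some undamped mode
escapes G: an eigenvalue c with Re c ≥ 0 forces (Σ + εB)u = νu and Gu = 0
(`quadratic_eigenvalue_re_neg`, `tendsto_sub_of_modal_equation`). So it suffices to exclude nonzero
u of this kind with zero block sums.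

For small ε this is a perturbation argument (`eq_zero_of_undamped_mode`). The gap σ̄ forces a unit
mode u close to a single block k; the gap μ̄ then forces that block close to an eigenvector w of
B_kk. The total error is at most δ = ε‖B‖(μ̄ + ‖B‖)/(σ̄μ̄), and w has zero sum. As Gu = 0, γ̄²‖w‖² ≤
wᵀG_kk w ≤ ‖G‖δ², while ‖w‖ ≥ 1 - δ. Hence γ̄ ≤ (√‖G‖ + γ̄)δ, which fails for ε below the bound.

The hypothesis on λ₂ enters only through γ̄ > 0. If w*G_kk w = 0 for an admissible w, then w is an
eigenvector of G_kk + jB_kk for jμ, independent of the kernel vector 1, so two eigenvalues have real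
part 0 (`dotProduct_pos_of_mem_unitEigenvectors`). -/

lemma tendsto_zero_of_hasDerivWithinAt_scalar {f g : ℝ → ℂ} {c : ℂ} (hc : c.re < 0)
    (hf : ∀ t ∈ Set.Ici (0 : ℝ), HasDerivWithinAt f (c * f t + g t) (Set.Ici 0) t)
    (hg : Tendsto g atTop (𝓝 0)) : Tendsto f atTop (𝓝 0) := by
  set a : ℝ := -c.re with ha
  have ha0 : 0 < a := by linarith
  suffices h : Tendsto (fun t => ‖f t‖ ^ 2) atTop (𝓝 0) by
    have h2 := h.sqrt
    simp only [Real.sqrt_sq (norm_nonneg _), Real.sqrt_zero] at h2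
    exact tendsto_zero_iff_norm_tendsto_zero.2 h2
  have hφ : ∀ t ∈ Set.Ici (0 : ℝ), HasDerivWithinAt (fun t => ‖f t‖ ^ 2)
      (2 * inner ℝ (f t) (c * f t + g t)) (Set.Ici 0) t := fun t ht => (hf t ht).norm_sq
  -- Young's inequality: half of the decay rate 2a absorbs the cross term with `g`.
  have hbound : ∀ t, 2 * inner ℝ (f t) (c * f t + g t) ≤ -a * ‖f t‖ ^ 2 + ‖g t‖ ^ 2 / a := by
    intro t
    have h1 : inner ℝ (f t) (c * f t + g t) = -a * ‖f t‖ ^ 2 + inner ℝ (f t) (g t) := by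
      rw [inner_add_right]
      congr 1
      rw [Complex.inner, ha, ← Complex.normSq_eq_norm_sq, Complex.normSq_apply]
      simp
      ring
    have h2 := real_inner_le_norm (f t) (g t)
    have h3 : 2 * (‖f t‖ * ‖g t‖) ≤ a * ‖f t‖ ^ 2 + ‖g t‖ ^ 2 / a := by
      have h4 : a * ‖f t‖ ^ 2 + ‖g t‖ ^ 2 / a - 2 * (‖f t‖ * ‖g t‖)
          = (a * ‖f t‖ - ‖g t‖) ^ 2 / a := by
        field_simp
        ring
      have h5 : 0 ≤ (a * ‖f t‖ - ‖g t‖) ^ 2 / a := by positivity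
      linarith
    rw [h1]
    linarith
  have hg2 : Tendsto (fun t => ‖g t‖ ^ 2 / a) atTop (𝓝 0) := by
    have := ((tendsto_zero_iff_norm_tendsto_zero.1 hg).pow 2).div_const a
    simpa using this
  rw [Metric.tendsto_atTop]
  intro ε hε
  obtain ⟨T, hT⟩ := eventually_atTop.1
    ((hg2.eventually (gt_mem_nhds (show 0 < a * (ε / 2) by positivity))).and
      (eventually_ge_atTop (0 : ℝ)))
  have hT0 : 0 ≤ T := (hT T le_rfl).2
  -- Grönwall with rate -a from time `T`: forcing below a·ε/2 contributes at most ε/2.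
  have hgr : ∀ t ≥ T, ‖f t‖ ^ 2 ≤ ‖f T‖ ^ 2 * Real.exp (-a * (t - T)) + ε / 2 := by
    intro t ht
    have hG := le_gronwallBound_of_liminf_deriv_right_le (f := fun t => ‖f t‖ ^ 2)
      (f' := fun t => 2 * inner ℝ (f t) (c * f t + g t)) (δ := ‖f T‖ ^ 2) (K := -a)
      (ε := a * (ε / 2)) (a := T) (b := t)
      (fun s hs => ((hφ s (hT0.trans hs.1)).continuousWithinAt).mono
        (fun r hr => hT0.trans hr.1))
      (fun s hs r hr => by
        have h1 : HasDerivWithinAt (fun t => ‖f t‖ ^ 2)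
            (2 * inner ℝ (f s) (c * f s + g s)) (Set.Ici s) s :=
          (hφ s (hT0.trans hs.1)).mono (fun r hr => (hT0.trans hs.1).trans hr)
        exact h1.liminf_right_slope_le hr)
      le_rfl
      (fun s hs => by
        have := hbound s
        have := (hT s hs.1).1
        linarith) t ⟨ht, le_rfl⟩
    refine hG.trans ?_
    rw [gronwallBound_of_K_ne_0 (by linarith)]
    have h6 : a * (ε / 2) / -a = -(ε / 2) := by field_simp
    rw [h6]
    have : 0 < Real.exp (-a * (t - T)) := Real.exp_pos _
    nlinarith
  have hexp : Tendsto (fun t => ‖f T‖ ^ 2 * Real.exp (-a * (t - T))) atTop (𝓝 0) := by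
    have h1 : Tendsto (fun t : ℝ => -a * (t - T)) atTop atBot :=
      (tendsto_atTop_add_const_right _ (-T) tendsto_id).const_mul_atTop_of_neg (by linarith)
    have := (Real.tendsto_exp_atBot.comp h1).const_mul (‖f T‖ ^ 2)
    simpa using this
  obtain ⟨N, hN⟩ := eventually_atTop.1
    ((hexp.eventually (gt_mem_nhds (show 0 < ε / 2 by positivity))).and
      (eventually_ge_atTop T))
  refine ⟨N, fun t ht => ?_⟩
  rw [Real.dist_eq, sub_zero, abs_of_nonneg (by positivity)]
  have := hgr t (hN t ht).2
  have := (hN t ht).1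
  linarith

/-- Factors are peeled off one at a time, avoiding Jordan forms: Y = AX - cX solves the same
equation and is killed by the remaining factors, so Y → 0 by induction, and each coordinate of X' =
cX + Y is a scalar equation. -/
lemma tendsto_zero_of_prod_apply_eq_zero {κ : Type*} [Fintype κ] (A : Module.End ℂ (κ → ℂ))
    (s : Multiset ℂ) (hs : ∀ c ∈ s, c.re < 0) (X : ℝ → κ → ℂ)
    (hX : ∀ t ∈ Set.Ici (0 : ℝ), HasDerivWithinAt X (A (X t)) (Set.Ici 0) t)
    (h0 : ∀ t ∈ Set.Ici (0 : ℝ),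
      Polynomial.aeval A (s.map fun c => Polynomial.X - Polynomial.C c).prod (X t) = 0) :
    Tendsto X atTop (𝓝 0) := by
  induction s using Multiset.induction generalizing X with
  | empty =>
    refine tendsto_const_nhds.congr' ?_
    filter_upwards [eventually_ge_atTop 0] with t ht
    simpa using (h0 t ht).symm
  | cons c s ih =>
    have hY := ih (fun d hd => hs d (Multiset.mem_cons_of_mem hd)) (fun t => A (X t) - c • X t)
      (fun t ht => by
        have h1 : HasDerivWithinAt (fun t => A (X t)) (A (A (X t))) (Set.Ici 0) t := by
          have h2 := ((LinearMap.toContinuousLinearMap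
            (A : (κ → ℂ) →ₗ[ℂ] (κ → ℂ))).restrictScalars ℝ).hasFDerivAt (x := X t)
          exact h2.comp_hasDerivWithinAt t (hX t ht)
        have h2 := h1.sub ((hX t ht).const_smul c)
        rwa [← map_smul, ← map_sub] at h2)
      (fun t ht => by
        have h1 := h0 t ht
        rw [Multiset.map_cons, Multiset.prod_cons, mul_comm, map_mul] at h1
        simpa [Algebra.algebraMap_eq_smul_one] using h1)
    rw [tendsto_pi_nhds] at hY ⊢
    intro k
    refine tendsto_zero_of_hasDerivWithinAt_scalar (hs c (Multiset.mem_cons_self _ _))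
      (fun t ht => ?_) (hY k)
    have := (hasDerivWithinAt_pi.1 (hX t ht)) k
    simpa using this

lemma tendsto_zero_of_eigenvalue_re_neg {κ : Type*} [Fintype κ] [DecidableEq κ]
    (A : Matrix κ κ ℂ)
    (hA : ∀ (c : ℂ) (u : κ → ℂ), u ≠ 0 → A *ᵥ u = c • u → c.re < 0) (X : ℝ → κ → ℂ)
    (hX : ∀ t ∈ Set.Ici (0 : ℝ), HasDerivWithinAt X (A *ᵥ X t) (Set.Ici 0) t) :
    Tendsto X atTop (𝓝 0) := by
  set p := minpoly ℂ (toLin' A)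
  have hp0 : p ≠ 0 := minpoly.ne_zero (Algebra.IsIntegral.isIntegral _)
  refine tendsto_zero_of_prod_apply_eq_zero (toLin' A) p.roots ?_ X hX ?_
  · intro c hc
    obtain ⟨u, hu⟩ := (Module.End.hasEigenvalue_of_isRoot
      ((Polynomial.mem_roots hp0).1 hc)).exists_hasEigenvector
    exact hA c u hu.2 (by simpa using hu.apply_eq_smul)
  · intro t _
    have h1 : (p.roots.map fun c => Polynomial.X - Polynomial.C c).prod = p :=
      ((IsAlgClosed.splits p).eq_prod_roots_of_monic
        (minpoly.monic (Algebra.IsIntegral.isIntegral _))).symm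
    rw [h1, minpoly.aeval]
    rfl

/-! ### Real quadratic forms and the quadratic eigenvalue problem -/

lemma dotProduct_mulVec_comm_of_isHermitian {ι : Type*} [Fintype ι] {A : Matrix ι ι ℝ}
    (hA : A.IsHermitian) (x y : ι → ℝ) : x ⬝ᵥ A *ᵥ y = y ⬝ᵥ A *ᵥ x := by
  have hT : Aᵀ = A := by rw [← conjTranspose_eq_transpose_of_trivial]; exact hA
  rw [dotProduct_mulVec, ← mulVec_transpose, hT, dotProduct_comm]

lemma mulVec_eq_zero_of_dotProduct_eq_zero {ι : Type*} [Fintype ι] {A : Matrix ι ι ℝ}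
    (hA : A.PosSemidef) {x : ι → ℝ} (h : x ⬝ᵥ A *ᵥ x = 0) : A *ᵥ x = 0 :=
  (hA.dotProduct_mulVec_zero_iff x).1 (by rwa [star_trivial])

lemma re_map_ofReal_mulVec {ι κ : Type*} [Fintype κ] (A : Matrix ι κ ℝ) (u : κ → ℂ) (i : ι) :
    ((A.map Complex.ofReal *ᵥ u) i).re = (A *ᵥ fun j => (u j).re) i := by
  simp [mulVec, dotProduct]

lemma im_map_ofReal_mulVec {ι κ : Type*} [Fintype κ] (A : Matrix ι κ ℝ) (u : κ → ℂ) (i : ι) :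
    ((A.map Complex.ofReal *ᵥ u) i).im = (A *ᵥ fun j => (u j).im) i := by
  simp [mulVec, dotProduct]

/-- Pair the equation with u*, where c = x + iy, and let N, h, g be the forms of I, H, G at u. The
real part is (x² - y²)N + h + xg = 0, the imaginary part y(2xN + g) = 0. If x ≥ 0, then y = 0
contradicts h > 0; otherwise x = g = 0, so Gu = 0 and Hu = y²u, which `hobs` excludes. -/
lemma quadratic_eigenvalue_re_neg {ι : Type*} [Fintype ι] [DecidableEq ι]
    {H G : Matrix ι ι ℝ} (hH : H.PosDef) (hG : G.PosSemidef)
    (hobs : ∀ (ν : ℝ) (u : ι → ℝ), H *ᵥ u = ν • u → G *ᵥ u = 0 → u = 0)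
    {c : ℂ} {u : ι → ℂ} (hu : u ≠ 0)
    (hc : c ^ 2 • u + H.map Complex.ofReal *ᵥ u + c • (G.map Complex.ofReal *ᵥ u) = 0) :
    c.re < 0 := by
  obtain ⟨x, y⟩ := c
  set a : ι → ℝ := fun i => (u i).re with ha
  set b : ι → ℝ := fun i => (u i).im with hb
  have hre : (x ^ 2 - y ^ 2) • a - (2 * x * y) • b + H *ᵥ a + x • (G *ᵥ a) - y • (G *ᵥ b) = 0 := by
    ext i
    have := congrArg Complex.re (congrFun hc i)
    simp only [Pi.add_apply, Pi.smul_apply, smul_eq_mul, Complex.add_re, Complex.mul_re,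
      re_map_ofReal_mulVec, im_map_ofReal_mulVec, pow_two, Complex.mul_im] at this
    simp only [Pi.add_apply, Pi.sub_apply, Pi.smul_apply, smul_eq_mul]
    simp only [Pi.zero_apply, Complex.zero_re] at this ⊢
    rw [← this]
    ring
  have him : (x ^ 2 - y ^ 2) • b + (2 * x * y) • a + H *ᵥ b + x • (G *ᵥ b) + y • (G *ᵥ a) = 0 := by
    ext i
    have := congrArg Complex.im (congrFun hc i)
    simp only [Pi.add_apply, Pi.smul_apply, smul_eq_mul, Complex.add_im, Complex.mul_re,
      re_map_ofReal_mulVec, im_map_ofReal_mulVec, pow_two, Complex.mul_im] at this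
    simp only [Pi.add_apply, Pi.smul_apply, smul_eq_mul]
    simp only [Pi.zero_apply, Complex.zero_im] at this ⊢
    rw [← this]
    ring
  have haa : 0 ≤ a ⬝ᵥ a := by simpa using dotProduct_star_self_nonneg a
  have hbb : 0 ≤ b ⬝ᵥ b := by simpa using dotProduct_star_self_nonneg b
  have hGa : 0 ≤ a ⬝ᵥ G *ᵥ a := by simpa using hG.dotProduct_mulVec_nonneg a
  have hGb : 0 ≤ b ⬝ᵥ G *ᵥ b := by simpa using hG.dotProduct_mulVec_nonneg b
  have hHa : 0 ≤ a ⬝ᵥ H *ᵥ a := by simpa using hH.posSemidef.dotProduct_mulVec_nonneg a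
  have hHb : 0 ≤ b ⬝ᵥ H *ᵥ b := by simpa using hH.posSemidef.dotProduct_mulVec_nonneg b
  have hab : a ≠ 0 ∨ b ≠ 0 := by
    by_contra! h
    exact hu (funext fun i => Complex.ext (congrFun h.1 i) (congrFun h.2 i))
  have hN : 0 < a ⬝ᵥ a + b ⬝ᵥ b := by
    rcases hab with h | h
    · have : 0 < a ⬝ᵥ a := by simpa using dotProduct_star_self_pos_iff.2 h
      linarith
    · have : 0 < b ⬝ᵥ b := by simpa using dotProduct_star_self_pos_iff.2 h
      linarith
  have hHN : 0 < a ⬝ᵥ H *ᵥ a + b ⬝ᵥ H *ᵥ b := by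
    rcases hab with h | h
    · have : 0 < a ⬝ᵥ H *ᵥ a := by simpa using hH.dotProduct_mulVec_pos h
      linarith
    · have : 0 < b ⬝ᵥ H *ᵥ b := by simpa using hH.dotProduct_mulVec_pos h
      linarith
  have e1 := congrArg (fun z => a ⬝ᵥ z) hre
  have e2 := congrArg (fun z => b ⬝ᵥ z) him
  have e3 := congrArg (fun z => a ⬝ᵥ z) him
  have e4 := congrArg (fun z => b ⬝ᵥ z) hre
  simp only [dotProduct_add, dotProduct_sub, dotProduct_smul, dotProduct_zero,
    smul_eq_mul] at e1 e2 e3 e4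
  have sG := dotProduct_mulVec_comm_of_isHermitian hG.1 a b
  have sH := dotProduct_mulVec_comm_of_isHermitian hH.1 a b
  have sI := dotProduct_comm a b
  by_contra! hx
  change 0 ≤ x at hx
  set N := a ⬝ᵥ a + b ⬝ᵥ b with hNdef
  set g := a ⬝ᵥ G *ᵥ a + b ⬝ᵥ G *ᵥ b with hgdef
  set h := a ⬝ᵥ H *ᵥ a + b ⬝ᵥ H *ᵥ b with hhdef
  have hg : 0 ≤ g := add_nonneg hGa hGb
  have E1 : (x ^ 2 - y ^ 2) * N + h + x * g = 0 := by
    rw [sG, sI] at e1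
    simp only [hNdef, hgdef, hhdef]
    linear_combination e1 + e2
  have E2 : y * (2 * x * N + g) = 0 := by
    rw [sI, sH, sG] at e3
    simp only [hNdef, hgdef]
    linear_combination e3 - e4
  rcases mul_eq_zero.1 E2 with hy | hy
  · subst hy
    have := mul_nonneg hx hg
    have : 0 ≤ x ^ 2 * N := by positivity
    nlinarith
  · have hxN : 0 ≤ x * N := by positivity
    have hg0 : g = 0 := by linarith only [hxN, hy, hg]
    have hx0 : x = 0 := by
      have : x * N = 0 := by linarith only [hxN, hy, hg]
      exact (mul_eq_zero.1 this).resolve_right hN.ne'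
    have ga : G *ᵥ a = 0 := mulVec_eq_zero_of_dotProduct_eq_zero hG
      (le_antisymm (by linarith only [hg0, hgdef, hGb]) hGa)
    have gb : G *ᵥ b = 0 := mulVec_eq_zero_of_dotProduct_eq_zero hG
      (le_antisymm (by linarith only [hg0, hgdef, hGa]) hGb)
    have ha0 : a = 0 := by
      refine hobs (y ^ 2) a ?_ ga
      rw [hx0, ga, gb] at hre
      simp only [mul_zero, zero_mul, zero_smul, smul_zero, sub_zero, add_zero] at hre
      rw [← sub_eq_zero, ← hre]
      module
    have hb0 : b = 0 := by
      refine hobs (y ^ 2) b ?_ gb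
      rw [hx0, ga, gb] at him
      simp only [mul_zero, zero_mul, zero_smul, smul_zero, add_zero] at him
      rw [← sub_eq_zero, ← him]
      module
    rcases hab with h | h
    · exact h ha0
    · exact h hb0

/-- A damped oscillator `z̈ + G ż + H z = 0` whose undamped modes are all seen by the
damping matrix `G` is asymptotically stable. -/
theorem tendsto_zero_of_observable {ι : Type*} [Fintype ι] [DecidableEq ι]
    {H G : Matrix ι ι ℝ} (hH : H.PosDef) (hG : G.PosSemidef)
    (hobs : ∀ (ν : ℝ) (u : ι → ℝ), H *ᵥ u = ν • u → G *ᵥ u = 0 → u = 0)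
    (z w a : ℝ → ι → ℝ)
    (hz : ∀ t ∈ Set.Ici (0 : ℝ), HasDerivWithinAt z (w t) (Set.Ici 0) t)
    (hw : ∀ t ∈ Set.Ici (0 : ℝ), HasDerivWithinAt w (a t) (Set.Ici 0) t)
    (heq : ∀ t ∈ Set.Ici (0 : ℝ), a t + H *ᵥ z t + G *ᵥ w t = 0) :
    Tendsto z atTop (𝓝 0) := by
  -- Companion matrix of the first-order system for (z, ż); its eigenvectors have the form (u, cu).
  set A : Matrix (ι ⊕ ι) (ι ⊕ ι) ℂ :=
    fromBlocks 0 1 (-(H.map Complex.ofReal)) (-(G.map Complex.ofReal)) with hA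
  have key := tendsto_zero_of_eigenvalue_re_neg A ?_
    (fun t => Sum.elim (fun i => (z t i : ℂ)) (fun i => (w t i : ℂ))) ?_
  · rw [tendsto_pi_nhds] at key ⊢
    intro i
    have h1 := (Complex.continuous_re.tendsto _).comp (key (Sum.inl i))
    simpa [Function.comp_def] using h1
  · intro c u hu hc
    obtain ⟨u1, u2, rfl⟩ : ∃ u1 u2, u = Sum.elim u1 u2 :=
      ⟨u ∘ Sum.inl, u ∘ Sum.inr, (Sum.elim_comp_inl_inr u).symm⟩
    rw [hA, fromBlocks_mulVec] at hc
    have h1 : u2 = c • u1 := by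
      ext i
      simpa using congrFun hc (Sum.inl i)
    have h2 : -(H.map Complex.ofReal *ᵥ u1) - (G.map Complex.ofReal *ᵥ u2) = c • u2 := by
      ext i
      simpa [neg_mulVec, sub_eq_add_neg] using congrFun hc (Sum.inr i)
    subst h1
    refine quadratic_eigenvalue_re_neg hH hG hobs (u := u1) ?_ ?_
    · rintro rfl
      apply hu
      ext i
      cases i <;> simp
    · rw [mulVec_smul] at h2
      rw [pow_two, mul_smul, ← h2]
      abel
  · intro t ht
    have hEq : A *ᵥ (Sum.elim (fun i => (z t i : ℂ)) (fun i => (w t i : ℂ)))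
        = Sum.elim (fun i => (w t i : ℂ)) (fun i => (a t i : ℂ)) := by
      rw [hA, fromBlocks_mulVec]
      ext i
      rcases i with i | i
      · simp
      · have := congrFun (heq t ht) i
        simp only [Pi.add_apply, Pi.zero_apply] at this
        have h1 : a t i = -(H *ᵥ z t) i - (G *ᵥ w t) i := by linarith
        simp only [Sum.elim_inr, h1, neg_mulVec, Pi.add_apply, Pi.neg_apply]
        apply Complex.ext
        · simp [re_map_ofReal_mulVec, sub_eq_add_neg]
        · simp [mulVec, dotProduct]
    rw [hEq, hasDerivWithinAt_pi]
    rintro (i | i)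
    · exact (hasDerivWithinAt_pi.1 (hz t ht) i).ofReal_comp
    · exact (hasDerivWithinAt_pi.1 (hw t ht) i).ofReal_comp

/-! ### Spectral gaps -/

/-- Take the eigenvalue α i₀ nearest to ν and project `u` onto its eigenspace. Any other eigenvalue
is at least 2d from α i₀ and no nearer to ν, hence at least d from ν, so A - ν expands the
complement by at least d. -/
lemma exists_eigenprojection {E ι : Type*} [NormedAddCommGroup E] [InnerProductSpace ℝ E]
    [Fintype ι] [Nonempty ι] (b : OrthonormalBasis ι ℝ E) (A : E →ₗ[ℝ] E) (α : ι → ℝ)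
    (hA : ∀ i, A (b i) = α i • b i) {d : ℝ} (hd0 : 0 ≤ d)
    (hd : ∀ i j, α i ≠ α j → 2 * d ≤ |α i - α j|) (ν : ℝ) (u : E) :
    ∃ i₀ w, A w = α i₀ • w ∧ (∀ c, A c = α i₀ • c → inner ℝ c (u - w) = 0) ∧
      d * ‖u - w‖ ≤ ‖A u - ν • u‖ := by
  have hrepr : ∀ x i, b.repr (A x) i = α i * b.repr x i := by
    intro x i
    have h1 : A x = ∑ j, b.repr x j • (α j • b j) := by
      conv_lhs => rw [← b.sum_repr x]
      simp [map_sum, hA]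
    classical
    rw [h1, map_sum]
    simp [Pi.single_apply, mul_comm]
  obtain ⟨i₀, -, hi₀⟩ := Finset.exists_min_image Finset.univ (fun i => |α i - ν|)
    Finset.univ_nonempty
  classical
  set w : E := b.repr.symm (WithLp.toLp 2 fun i => if α i = α i₀ then b.repr u i else 0) with hw
  have hwr : ∀ i, b.repr w i = if α i = α i₀ then b.repr u i else 0 := by
    intro i
    rw [hw, LinearIsometryEquiv.apply_symm_apply]
  refine ⟨i₀, w, ?_, ?_, ?_⟩
  · apply b.repr.injective
    ext i
    rw [hrepr, map_smul]
    simp only [PiLp.smul_apply, smul_eq_mul, hwr]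
    split_ifs with h
    · rw [h]
    · simp
  · intro c hc
    rw [← b.repr.inner_map_map, PiLp.inner_apply]
    refine Finset.sum_eq_zero fun i _ => ?_
    rw [map_sub, PiLp.sub_apply, hwr]
    split_ifs with h
    · simp
    · have h1 := hrepr c i
      rw [hc, map_smul, PiLp.smul_apply, smul_eq_mul] at h1
      have h2 : (α i - α i₀) * b.repr c i = 0 := by linarith
      have h3 := (mul_eq_zero.1 h2).resolve_left (sub_ne_zero.2 h)
      simp [h3]
  · refine le_of_sq_le_sq ?_ (norm_nonneg _)
    rw [mul_pow, ← b.repr.norm_map (u - w), ← b.repr.norm_map (A u - ν • u),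
      EuclideanSpace.norm_sq_eq, EuclideanSpace.norm_sq_eq, Finset.mul_sum]
    refine Finset.sum_le_sum fun i _ => ?_
    simp only [map_sub, map_smul, PiLp.sub_apply, PiLp.smul_apply, hrepr, hwr, smul_eq_mul,
      Real.norm_eq_abs, sq_abs]
    split_ifs with h
    · rw [sub_self]
      nlinarith [sq_nonneg (α i * b.repr u i - ν * b.repr u i)]
    · have h1 := hd i i₀ h
      have h2 := hi₀ i (Finset.mem_univ i)
      have h3 : |α i - α i₀| ≤ |α i - ν| + |α i₀ - ν| := by
        rw [abs_sub_comm (α i₀) ν]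
        exact abs_sub_le _ _ _
      have h4 : d ≤ |α i - ν| := by linarith
      have h5 : d ^ 2 ≤ (α i - ν) ^ 2 := by
        rw [← sq_abs (α i - ν)]
        exact pow_le_pow_left₀ hd0 h4 2
      rw [sub_zero, ← sub_mul, mul_pow]
      exact mul_le_mul_of_nonneg_right h5 (sq_nonneg _)

lemma csInf_pos_of_finite {s : Set ℝ} (hs : s.Finite) (hne : s.Nonempty) (h : ∀ x ∈ s, 0 < x) :
    0 < sInf s := h _ (hne.csInf_mem hs)

lemma two_mul_sigmaBar_le {n : ℕ} (σ : Fin n → ℝ) {k l : Fin n} (h : k ≠ l) :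
    2 * sigmaBar σ ≤ |σ k - σ l| := by
  have : sInf {d | ∃ k l, k ≠ l ∧ d = |σ k - σ l|} ≤ |σ k - σ l| :=
    csInf_le ⟨0, by rintro _ ⟨k, l, -, rfl⟩; exact abs_nonneg _⟩ ⟨k, l, h, rfl⟩
  rw [sigmaBar]
  linarith

lemma sigmaBar_pos {n : ℕ} {σ : Fin n → ℝ} (hσ : Function.Injective σ) (hn : 2 ≤ n) :
    0 < sigmaBar σ := by
  refine mul_pos (by norm_num) (csInf_pos_of_finite ?_ ?_ ?_)
  · refine (Set.finite_range fun p : Fin n × Fin n => |σ p.1 - σ p.2|).subset ?_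
    rintro _ ⟨k, l, -, rfl⟩
    exact ⟨(k, l), rfl⟩
  -- Nonemptiness matters: the real `sInf` of the empty set is 0.
  · exact ⟨_, ⟨0, by omega⟩, ⟨1, by omega⟩, by simp, rfl⟩
  · rintro _ ⟨k, l, h, rfl⟩
    exact abs_pos.2 (sub_ne_zero.2 (hσ.ne h))

lemma two_mul_muBar_le {q n : ℕ} (B : Fin n → Matrix (Fin q) (Fin q) ℝ) {k : Fin n} {a b : ℝ}
    (ha : a ∈ spectrum ℝ (B k)) (hb : b ∈ spectrum ℝ (B k)) (hab : a ≠ b) :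
    2 * muBar B ≤ |a - b| := by
  have : sInf {d | ∃ k, ∃ a ∈ spectrum ℝ (B k), ∃ b ∈ spectrum ℝ (B k),
      a ≠ b ∧ d = |a - b|} ≤ |a - b| :=
    csInf_le ⟨0, by rintro _ ⟨k, a, -, b, -, -, rfl⟩; exact abs_nonneg _⟩
      ⟨k, a, ha, b, hb, hab, rfl⟩
  rw [muBar]
  linarith

lemma muBar_pos {q n : ℕ} {B : Fin n → Matrix (Fin q) (Fin q) ℝ}
    (hB : ∃ k, ∃ a ∈ spectrum ℝ (B k), ∃ b ∈ spectrum ℝ (B k), a ≠ b) : 0 < muBar B := by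
  refine mul_pos (by norm_num) (csInf_pos_of_finite ?_ ?_ ?_)
  · refine (Set.finite_iUnion fun k => ((Matrix.finite_real_spectrum (A := B k)).prod
      (Matrix.finite_real_spectrum (A := B k))).image fun p => |p.1 - p.2|).subset ?_
    rintro _ ⟨k, a, ha, b, hb, -, rfl⟩
    exact Set.mem_iUnion.2 ⟨k, (a, b), ⟨ha, hb⟩, rfl⟩
  · obtain ⟨k, a, ha, b, hb, hab⟩ := hB
    exact ⟨_, k, a, ha, b, hb, hab, rfl⟩
  · rintro _ ⟨k, a, -, b, -, hab, rfl⟩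
    exact abs_pos.2 (sub_ne_zero.2 hab)

/-! ### The second eigenvalue of the admittance matrix -/

/-- Index 1 is the second entry. Were it positive, so would be all later ones, leaving room for only
one zero. -/
lemma getD_one_sort_nonpos {s : Multiset ℝ} (hs : 2 ≤ s.count 0) :
    (s.sort (· ≤ ·)).getD 1 0 ≤ 0 := by
  have h1 : 2 ≤ (s.sort (· ≤ ·)).count 0 := by
    rwa [← Multiset.coe_count, Multiset.sort_eq]
  have h2 := s.pairwise_sort (· ≤ ·)
  generalize s.sort (· ≤ ·) = l at h1 h2
  match l, h1, h2 with
  | [], _, _ => simp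
  | [a], _, _ => simp
  | a :: b :: t, h1, h2 =>
    by_contra! hb
    have hb' : 0 < b := by simpa using hb
    have h3 : (b :: t).count 0 = 0 := by
      rw [List.count_eq_zero]
      intro h0
      rw [List.pairwise_cons, List.pairwise_cons] at h2
      rcases List.mem_cons.1 h0 with h | h
      · exact hb'.ne h
      · exact absurd (h2.2.1 0 h) (not_le.2 hb')
    have h4 := List.count_cons (a := (0 : ℝ)) (b := a) (l := b :: t)
    rw [h3] at h4
    split_ifs at h4 <;> omega

/-- Geometric multiplicity is at most algebraic, so 0 and c together account for two characteristic
roots, also when c = 0; both have real part 0. -/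
lemma reEigenvalue_two_nonpos {m : ℕ} {X : Matrix (Fin m) (Fin m) ℂ} {p w : Fin m → ℂ} {c : ℂ}
    (hpw : LinearIndependent ℂ ![p, w]) (hp : X *ᵥ p = 0) (hw : X *ᵥ w = c • w)
    (hc : c.re = 0) : reEigenvalue X 2 ≤ 0 := by
  refine getD_one_sort_nonpos ?_
  have hmult : ∀ d : ℂ, Module.finrank ℂ (Module.End.eigenspace (toLin' X) d)
      ≤ X.charpoly.roots.count d := by
    intro d
    rw [Polynomial.count_roots, ← charpoly_toLin']
    exact LinearMap.finrank_eigenspace_le _ d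
  have hp0 : p ≠ 0 := by simpa using hpw.ne_zero 0
  have hw0 : w ≠ 0 := by simpa using hpw.ne_zero 1
  have hpm : p ∈ Module.End.eigenspace (toLin' X) 0 := by
    rw [Module.End.mem_eigenspace_iff]; simpa using hp
  have hwm : w ∈ Module.End.eigenspace (toLin' X) c := by
    rw [Module.End.mem_eigenspace_iff]; simpa using hw
  have hsub : ({0, c} : Multiset ℂ) ≤ X.charpoly.roots := by
    by_cases h0 : c = 0
    · subst h0
      change Multiset.replicate 2 0 ≤ _
      refine Multiset.le_count_iff_replicate_le.1 (le_trans ?_ (hmult 0))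
      have h1 : LinearIndependent ℂ
          (![⟨p, hpm⟩, ⟨w, hwm⟩] : Fin 2 → Module.End.eigenspace (toLin' X) 0) := by
        rw [LinearIndependent.pair_iff] at hpw ⊢
        exact fun s t hst => hpw s t (congrArg Subtype.val hst)
      simpa using h1.fintype_card_le_finrank
    · rw [Multiset.le_iff_subset (by simpa using Ne.symm h0)]
      intro d hd
      have hd' : d = 0 ∨ d = c := by simpa using hd
      have h1 : ∃ x ∈ Module.End.eigenspace (toLin' X) d, x ≠ 0 := by
        rcases hd' with rfl | rfl
        exacts [⟨p, hpm, hp0⟩, ⟨w, hwm, hw0⟩]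
      have h2 : 0 < Module.finrank ℂ (Module.End.eigenspace (toLin' X) d) := by
        obtain ⟨x, hx, hx0⟩ := h1
        exact Module.finrank_pos_iff_exists_ne_zero.2 ⟨⟨x, hx⟩, fun h => hx0 (congrArg (·.1) h)⟩
      exact Multiset.count_pos.1 (h2.trans_le (hmult d))
  have h2 := Multiset.count_le_of_le 0 (Multiset.map_le_map hsub (f := Complex.re))
  refine le_trans ?_ h2
  simp [hc]

lemma star_dotProduct_map_ofReal_mulVec {ι : Type*} [Fintype ι] (G : Matrix ι ι ℝ) (w : ι → ℂ) :
    (star w ⬝ᵥ (G.map Complex.ofReal *ᵥ w)).re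
      = (fun i => (w i).re) ⬝ᵥ G *ᵥ (fun i => (w i).re)
        + (fun i => (w i).im) ⬝ᵥ G *ᵥ (fun i => (w i).im) := by
  simp only [dotProduct, Complex.re_sum, Pi.star_apply, Complex.mul_re, re_map_ofReal_mulVec,
    im_map_ofReal_mulVec, ← Finset.sum_add_distrib]
  simp

lemma star_dotProduct_map_ofReal_mulVec_im {ι : Type*} [Fintype ι] {G : Matrix ι ι ℝ}
    (hG : G.IsHermitian) (w : ι → ℂ) :
    (star w ⬝ᵥ (G.map Complex.ofReal *ᵥ w)).im = 0 := by
  have h := dotProduct_mulVec_comm_of_isHermitian hG (fun i => (w i).re) (fun i => (w i).im)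
  have : (star w ⬝ᵥ (G.map Complex.ofReal *ᵥ w)).im
      = (fun i => (w i).re) ⬝ᵥ G *ᵥ (fun i => (w i).im)
        - (fun i => (w i).im) ⬝ᵥ G *ᵥ (fun i => (w i).re) := by
    simp only [dotProduct, Complex.im_sum, Pi.star_apply, Complex.mul_im, re_map_ofReal_mulVec,
      im_map_ofReal_mulVec, ← Finset.sum_sub_distrib]
    simp [sub_eq_add_neg]
  rw [this, h, sub_self]

lemma map_ofReal_mulVec_ofReal {ι κ : Type*} [Fintype κ] (A : Matrix ι κ ℝ) (x : κ → ℝ) :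
    A.map Complex.ofReal *ᵥ (fun j => (x j : ℂ)) = fun i => ((A *ᵥ x) i : ℂ) := by
  ext i
  simp [mulVec, dotProduct]

lemma map_ofReal_mulVec_eq_zero {ι : Type*} [Fintype ι] {G : Matrix ι ι ℝ} (hG : G.PosSemidef)
    {w : ι → ℂ} (h : (star w ⬝ᵥ (G.map Complex.ofReal *ᵥ w)).re ≤ 0) :
    G.map Complex.ofReal *ᵥ w = 0 := by
  rw [star_dotProduct_map_ofReal_mulVec] at h
  have h1 : 0 ≤ (fun i => (w i).re) ⬝ᵥ G *ᵥ (fun i => (w i).re) := by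
    simpa using hG.dotProduct_mulVec_nonneg (fun i => (w i).re)
  have h2 : 0 ≤ (fun i => (w i).im) ⬝ᵥ G *ᵥ (fun i => (w i).im) := by
    simpa using hG.dotProduct_mulVec_nonneg (fun i => (w i).im)
  ext i
  apply Complex.ext
  · rw [re_map_ofReal_mulVec, mulVec_eq_zero_of_dotProduct_eq_zero hG (by linarith)]
    rfl
  · rw [im_map_ofReal_mulVec, mulVec_eq_zero_of_dotProduct_eq_zero hG (by linarith)]
    rfl

lemma dotProduct_pos_of_mem_unitEigenvectors {q : ℕ} {G B : Matrix (Fin q) (Fin q) ℝ}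
    (hG : G.PosSemidef) (hG1 : G *ᵥ 1 = 0) (hB1 : B *ᵥ 1 = 0)
    (hlam : 0 < reEigenvalue (admittance G B) 2) {w : EuclideanSpace ℂ (Fin q)}
    (hw : w ∈ unitEigenvectors B) :
    0 < (star w.ofLp ⬝ᵥ (G.map Complex.ofReal *ᵥ w.ofLp)).re := by
  by_contra! h
  obtain ⟨hw1, ⟨μ, hμ⟩, hwo⟩ := hw
  have hGw := map_ofReal_mulVec_eq_zero hG h
  have hBw : B.map Complex.ofReal *ᵥ w.ofLp = (μ : ℂ) • w.ofLp := by
    rwa [sub_mulVec, smul_mulVec, one_mulVec, sub_eq_zero] at hμ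
  have hw0 : w.ofLp ≠ 0 := by
    intro h0
    have : w = 0 := by ext i; exact congrFun h0 i
    simp [this] at hw1
  have hsum : ∑ i, w i = 0 := by
    rcases Nat.eq_zero_or_pos q with rfl | hq
    · simp
    · simp only [oneVec, dotProduct, ← Finset.mul_sum] at hwo
      refine (mul_eq_zero.1 hwo).resolve_left ?_
      have : (0 : ℝ) < q := by exact_mod_cast hq
      exact Complex.ofReal_ne_zero.2 (by positivity)
  have hone : (fun j => ((1 : Fin q → ℝ) j : ℂ)) = 1 := by ext; simp
  refine absurd hlam (not_lt.2 (reEigenvalue_two_nonpos (p := 1) (w := w.ofLp)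
    (c := Complex.I * μ) ?_ ?_ ?_ (by simp)))
  · rw [LinearIndependent.pair_iff]
    intro s t hst
    have h1 := congrArg (fun z => ∑ i, z i) hst
    simp only [Pi.add_apply, Pi.smul_apply, smul_eq_mul, Finset.sum_add_distrib,
      ← Finset.mul_sum, hsum] at h1
    have hq : (q : ℂ) ≠ 0 := by
      rintro h0
      obtain rfl : q = 0 := by exact_mod_cast h0
      exact hw0 (Subsingleton.elim _ _)
    have hs : s = 0 := by simpa [hq] using h1
    subst hs
    simp only [zero_smul, zero_add] at hst
    exact ⟨rfl, (smul_eq_zero.1 hst).resolve_right hw0⟩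
  · rw [admittance, add_mulVec, smul_mulVec, ← hone, map_ofReal_mulVec_ofReal,
      map_ofReal_mulVec_ofReal, hG1, hB1]
    ext; simp
  · rw [admittance, add_mulVec, smul_mulVec, hGw, hBw, zero_add, smul_smul]

/-- On the unit sphere the eigenvalue is the Rayleigh quotient w*Bw, real for symmetric B.
Substituting it removes the quantifier over μ and leaves a closed condition. -/
lemma isCompact_unitEigenvectors {q : ℕ} {B : Matrix (Fin q) (Fin q) ℝ} (hB : B.IsHermitian) :
    IsCompact (unitEigenvectors B) := by
  have : unitEigenvectors B = Metric.sphere 0 1 ∩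
      {w | B.map Complex.ofReal *ᵥ w.ofLp
          = (star w.ofLp ⬝ᵥ (B.map Complex.ofReal *ᵥ w.ofLp)) • w.ofLp ∧
        oneVec q ⬝ᵥ w.ofLp = 0} := by
    ext w
    simp only [unitEigenvectors, Set.mem_ofPred_eq, Set.mem_inter_iff, mem_sphere_zero_iff_norm]
    refine and_congr_right fun hw => and_congr_left fun _ => ?_
    have hww : star w.ofLp ⬝ᵥ w.ofLp = 1 := by
      rw [dotProduct_comm, ← EuclideanSpace.inner_eq_star_dotProduct,
        inner_self_eq_norm_sq_to_K, hw]
      simp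
    simp only [sub_mulVec, smul_mulVec, one_mulVec, sub_eq_zero]
    constructor
    · rintro ⟨μ, hμ⟩
      rw [hμ, dotProduct_smul, hww, smul_eq_mul, mul_one]
    · intro h
      refine ⟨(star w.ofLp ⬝ᵥ (B.map Complex.ofReal *ᵥ w.ofLp)).re, ?_⟩
      rw [h]
      congr 1
      apply Complex.ext
      · rw [← h]; simp
      · rw [← h, star_dotProduct_map_ofReal_mulVec_im hB]; simp
  rw [this]
  refine (isCompact_sphere _ _).inter_right ?_
  have h0 : Continuous fun w : EuclideanSpace ℂ (Fin q) => w.ofLp :=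
    PiLp.continuous_ofLp 2 _
  have h1 : Continuous fun w : EuclideanSpace ℂ (Fin q) => B.map Complex.ofReal *ᵥ w.ofLp :=
    Continuous.matrix_mulVec continuous_const h0
  have h2 : Continuous fun w : EuclideanSpace ℂ (Fin q) =>
      star w.ofLp ⬝ᵥ (B.map Complex.ofReal *ᵥ w.ofLp) := h0.star.dotProduct h1
  exact (isClosed_eq h1 (h2.smul h0)).inter
    (isClosed_eq (continuous_const.dotProduct h0) continuous_const)

lemma gammaBar_sq_le {q n : ℕ} {G B : Fin n → Matrix (Fin q) (Fin q) ℝ}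
    (hG : ∀ k, (G k).PosSemidef) {k : Fin n} {w : EuclideanSpace ℂ (Fin q)}
    (hw : w ∈ unitEigenvectors (B k)) :
    gammaBar G B ^ 2 ≤ (star w.ofLp ⬝ᵥ ((G k).map Complex.ofReal *ᵥ w.ofLp)).re := by
  have hnn : ∀ (k : Fin n) (w : EuclideanSpace ℂ (Fin q)),
      0 ≤ (star w.ofLp ⬝ᵥ ((G k).map Complex.ofReal *ᵥ w.ofLp)).re := by
    intro k w
    rw [star_dotProduct_map_ofReal_mulVec]
    have h1 := (hG k).dotProduct_mulVec_nonneg (fun i => (w i).re)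
    have h2 := (hG k).dotProduct_mulVec_nonneg (fun i => (w i).im)
    simp only [star_trivial] at h1 h2
    exact add_nonneg h1 h2
  rw [gammaBar, Real.sq_sqrt]
  · exact csInf_le ⟨0, by rintro _ ⟨k, w, -, rfl⟩; exact hnn k w⟩ ⟨k, w, hw, rfl⟩
  · exact Real.sInf_nonneg (by rintro _ ⟨k, w, -, rfl⟩; exact hnn k w)

/-- The values form a finite union of continuous images of compact sets, so the infimum is attained.
-/
lemma gammaBar_pos {q n : ℕ} {G B : Fin n → Matrix (Fin q) (Fin q) ℝ}
    (hB : ∀ k, (B k).IsHermitian) (hne : ∃ k, (unitEigenvectors (B k)).Nonempty)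
    (hpos : ∀ k, ∀ w ∈ unitEigenvectors (B k),
      0 < (star w.ofLp ⬝ᵥ ((G k).map Complex.ofReal *ᵥ w.ofLp)).re) :
    0 < gammaBar G B := by
  refine Real.sqrt_pos.2 ?_
  have hset : {c | ∃ k, ∃ w ∈ unitEigenvectors (B k),
      c = (star w.ofLp ⬝ᵥ ((G k).map Complex.ofReal *ᵥ w.ofLp)).re}
      = ⋃ k, (fun w : EuclideanSpace ℂ (Fin q) =>
        (star w.ofLp ⬝ᵥ ((G k).map Complex.ofReal *ᵥ w.ofLp)).re) '' unitEigenvectors (B k) := by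
    ext c
    simp [eq_comm]
  have hcomp : IsCompact {c | ∃ k, ∃ w ∈ unitEigenvectors (B k),
      c = (star w.ofLp ⬝ᵥ ((G k).map Complex.ofReal *ᵥ w.ofLp)).re} := by
    rw [hset]
    refine isCompact_iUnion fun k => (isCompact_unitEigenvectors (hB k)).image ?_
    have h0 : Continuous fun w : EuclideanSpace ℂ (Fin q) => w.ofLp :=
      PiLp.continuous_ofLp 2 _
    exact Complex.continuous_re.comp
      (h0.star.dotProduct (Continuous.matrix_mulVec continuous_const h0))
  obtain ⟨k, w, hw⟩ := hne
  obtain ⟨k', w', hw', h⟩ := hcomp.sInf_mem ⟨_, k, w, hw, rfl⟩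
  rw [h]
  exact hpos k' w' hw'

lemma ofReal_mem_unitEigenvectors {q : ℕ} {B : Matrix (Fin q) (Fin q) ℝ}
    {w : EuclideanSpace ℝ (Fin q)} (hw : ‖w‖ = 1) {μ : ℝ} (hμ : B *ᵥ w.ofLp = μ • w.ofLp)
    (h1 : ∑ i, w i = 0) :
    (WithLp.toLp 2 fun i => ((w i : ℝ) : ℂ)) ∈ unitEigenvectors B := by
  refine ⟨?_, ⟨μ, ?_⟩, ?_⟩
  · rw [EuclideanSpace.norm_eq] at hw ⊢
    simpa using hw
  · rw [sub_mulVec, map_ofReal_mulVec_ofReal, hμ, smul_mulVec, one_mulVec, sub_eq_zero]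
    ext; simp
  · simp only [oneVec, dotProduct, ← Finset.mul_sum, ← Complex.ofReal_sum, h1]
    simp

lemma gammaBar_sq_mul_norm_sq_le {q n : ℕ} {G B : Fin n → Matrix (Fin q) (Fin q) ℝ}
    (hG : ∀ k, (G k).PosSemidef) {k : Fin n} {w : EuclideanSpace ℝ (Fin q)} {μ : ℝ}
    (hμ : B k *ᵥ w.ofLp = μ • w.ofLp) (h1 : ∑ i, w i = 0) :
    gammaBar G B ^ 2 * ‖w‖ ^ 2 ≤ w.ofLp ⬝ᵥ G k *ᵥ w.ofLp := by
  by_cases h0 : w = 0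
  · simp [h0]
  have hn : 0 < ‖w‖ := norm_pos_iff.2 h0
  have hmem := ofReal_mem_unitEigenvectors (B := B k) (w := ‖w‖⁻¹ • w) (μ := μ)
    (by rw [norm_smul, norm_inv, norm_norm, inv_mul_cancel₀ hn.ne'])
    (by rw [WithLp.ofLp_smul, mulVec_smul, hμ, smul_comm])
    (by simp [← Finset.mul_sum, h1])
  have h2 := gammaBar_sq_le hG hmem
  rw [star_dotProduct_map_ofReal_mulVec] at h2
  simp only [Complex.ofReal_re, Complex.ofReal_im] at h2
  have h3 : (fun i => (‖w‖⁻¹ • w) i) = ‖w‖⁻¹ • w.ofLp := rfl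
  have h4 : (fun _ : Fin q => (0 : ℝ)) = 0 := rfl
  rw [h3, h4, zero_dotProduct, add_zero, mulVec_smul, dotProduct_smul, smul_dotProduct,
    smul_eq_mul, smul_eq_mul] at h2
  calc gammaBar G B ^ 2 * ‖w‖ ^ 2
      ≤ ‖w‖⁻¹ * (‖w‖⁻¹ * (w.ofLp ⬝ᵥ G k *ᵥ w.ofLp)) * ‖w‖ ^ 2 := by gcongr
    _ = _ := by field_simp

/-! ### Perturbation of the undamped modes -/

lemma sum_eq_zero_of_mulVec_eq {q : ℕ} {X : Matrix (Fin q) (Fin q) ℝ} (hX : X.IsHermitian)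
    (hX1 : X *ᵥ 1 = 0) {w : Fin q → ℝ} {c : ℝ} (hc : X *ᵥ w = c • w) (hc0 : c ≠ 0) :
    ∑ i, w i = 0 := by
  have h1 := dotProduct_mulVec_comm_of_isHermitian hX 1 w
  rw [hX1, hc, dotProduct_zero, dotProduct_smul, smul_eq_mul, one_dotProduct] at h1
  exact (mul_eq_zero.1 h1).resolve_left hc0

lemma norm_mulVec_le_norm2 {ι : Type*} [Fintype ι] [DecidableEq ι] (X : Matrix ι ι ℝ)
    (x : EuclideanSpace ℝ ι) : ‖WithLp.toLp 2 (X *ᵥ x.ofLp)‖ ≤ norm2 X * ‖x‖ :=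
  (toEuclideanCLM (𝕜 := ℝ) X).le_opNorm x

lemma norm2_nonneg {ι : Type*} [Fintype ι] [DecidableEq ι] (X : Matrix ι ι ℝ) : 0 ≤ norm2 X :=
  norm_nonneg _

lemma norm2_pos {ι : Type*} [Fintype ι] [DecidableEq ι] {X : Matrix ι ι ℝ} (hX : X ≠ 0) :
    0 < norm2 X :=
  norm_pos_iff.2 fun h => hX (toEuclideanCLM.injective (h.trans (map_zero _).symm))

lemma dotProduct_mulVec_le_norm2 {ι : Type*} [Fintype ι] [DecidableEq ι] (X : Matrix ι ι ℝ)
    (x : EuclideanSpace ℝ ι) : x.ofLp ⬝ᵥ X *ᵥ x.ofLp ≤ norm2 X * ‖x‖ ^ 2 := by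
  rw [← inner_toEuclideanCLM]
  calc _ ≤ ‖x‖ * ‖toEuclideanCLM (𝕜 := ℝ) X x‖ := real_inner_le_norm _ _
    _ ≤ ‖x‖ * (norm2 X * ‖x‖) := by gcongr; exact norm_mulVec_le_norm2 X x
    _ = _ := by ring

/-- The vector of `ℝⁿ ⊗ ℝ^q` with `k`-th block `w` and all other blocks `0`. -/
def embedBlock {q n : ℕ} (k : Fin n) (w : EuclideanSpace ℝ (Fin q)) :
    EuclideanSpace ℝ (Fin n × Fin q) :=
  WithLp.toLp 2 fun p => if p.1 = k then w p.2 else 0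

/-- The `k`-th block of a vector of `ℝⁿ ⊗ ℝ^q`. -/
def restrictBlock {q n : ℕ} (k : Fin n) (u : EuclideanSpace ℝ (Fin n × Fin q)) :
    EuclideanSpace ℝ (Fin q) :=
  WithLp.toLp 2 fun i => u (k, i)

/-- The `k`-th diagonal block of a matrix. -/
abbrev diagBlock {q n : ℕ} (X : Matrix (Fin n × Fin q) (Fin n × Fin q) ℝ) (k : Fin n) :
    Matrix (Fin q) (Fin q) ℝ :=
  X.submatrix (fun i => (k, i)) (fun i => (k, i))

lemma norm_embedBlock {q n : ℕ} (k : Fin n) (w : EuclideanSpace ℝ (Fin q)) :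
    ‖embedBlock k w‖ = ‖w‖ := by
  rw [EuclideanSpace.norm_eq, EuclideanSpace.norm_eq, Fintype.sum_prod_type,
    Finset.sum_eq_single k]
  · simp [embedBlock]
  · intro l _ hl
    simp [embedBlock, hl]
  · simp

lemma norm_restrictBlock_le {q n : ℕ} (k : Fin n) (u : EuclideanSpace ℝ (Fin n × Fin q)) :
    ‖restrictBlock k u‖ ≤ ‖u‖ := by
  rw [EuclideanSpace.norm_eq, EuclideanSpace.norm_eq, Fintype.sum_prod_type]
  refine Real.sqrt_le_sqrt ?_
  exact Finset.single_le_sum (f := fun k => ∑ i, ‖u (k, i)‖ ^ 2)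
    (fun l _ => Finset.sum_nonneg fun i _ => sq_nonneg _) (Finset.mem_univ k)

lemma embedBlock_sub {q n : ℕ} (k : Fin n) (w w' : EuclideanSpace ℝ (Fin q)) :
    embedBlock k w - embedBlock k w' = embedBlock k (w - w') := by
  ext p
  simp only [embedBlock, PiLp.sub_apply]
  split_ifs <;> simp

lemma mulVec_embedBlock {q n : ℕ} (X : Matrix (Fin n × Fin q) (Fin n × Fin q) ℝ) (k : Fin n)
    (w : EuclideanSpace ℝ (Fin q)) (i : Fin q) :
    (X *ᵥ (embedBlock k w).ofLp) (k, i) = (diagBlock X k *ᵥ w.ofLp) i := by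
  simp only [mulVec, dotProduct, embedBlock, Fintype.sum_prod_type, submatrix_apply]
  rw [Finset.sum_eq_single k]
  · simp
  · intro l _ hl
    simp [hl]
  · simp

lemma dotProduct_embedBlock {q n : ℕ} (f : Fin n × Fin q → ℝ) (k : Fin n)
    (w : EuclideanSpace ℝ (Fin q)) :
    (embedBlock k w).ofLp ⬝ᵥ f = w.ofLp ⬝ᵥ fun i => f (k, i) := by
  simp only [dotProduct, embedBlock, Fintype.sum_prod_type]
  rw [Finset.sum_eq_single k]
  · simp
  · intro l _ hl
    simp [hl]
  · simp

lemma exists_block_projection {q n : ℕ} {σ : Fin n → ℝ} {s : ℝ} (hs : 0 < s)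
    (hσ : ∀ k l, k ≠ l → 2 * s ≤ |σ k - σ l|) (ν : ℝ) {u : EuclideanSpace ℝ (Fin n × Fin q)}
    (hu : u ≠ 0) :
    ∃ k, s * ‖u - embedBlock k (restrictBlock k u)‖
      ≤ ‖WithLp.toLp 2 (fun p : Fin n × Fin q => σ p.1 * u p - ν * u p)‖ := by
  have : Nonempty (Fin n × Fin q) := by
    by_contra h
    rw [not_nonempty_iff] at h
    exact hu (Subsingleton.elim _ _)
  set A := toEuclideanLin (𝕜 := ℝ) (diagonal fun p : Fin n × Fin q => σ p.1) with hA
  have hAx : ∀ (x : EuclideanSpace ℝ (Fin n × Fin q)) p, A x p = σ p.1 * x p := by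
    intro x p
    simp [hA, toLpLin_apply, mulVec_diagonal]
  obtain ⟨⟨k, j⟩, w, hw, horth, hle⟩ := exists_eigenprojection
    (EuclideanSpace.basisFun (Fin n × Fin q) ℝ) A (fun p => σ p.1)
    (by
      intro p
      ext r
      rw [hAx]
      by_cases h : r = p
      · subst h; simp
      · simp [h])
    hs.le (fun p r h => hσ _ _ fun h' => h (by rw [h'])) ν u
  refine ⟨k, ?_⟩
  have hwk : w = embedBlock k (restrictBlock k u) := by
    ext ⟨l, i⟩
    by_cases hl : l = k
    · subst hl
      -- Each basis vector of block k lies in the eigenspace, so orthogonality of the residual to it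
      -- makes the coordinates of `u` and `w` agree there.
      have := horth (EuclideanSpace.single (l, i) 1) (by
        ext r
        rw [hAx]
        by_cases h : r = (l, i)
        · subst h; simp
        · simp [h])
      simp only [EuclideanSpace.inner_single_left, map_one, one_mul, PiLp.sub_apply] at this
      simp only [embedBlock, restrictBlock, if_true]
      linarith
    · have h1 := congrArg (fun x : EuclideanSpace ℝ (Fin n × Fin q) => x (l, i)) hw
      simp only [hAx, PiLp.smul_apply, smul_eq_mul] at h1
      have h2 : (σ l - σ k) * w (l, i) = 0 := by linarith
      have h3 : σ l - σ k ≠ 0 := fun h => by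
        have := hσ l k hl
        rw [h, abs_zero] at this
        linarith
      rw [(mul_eq_zero.1 h2).resolve_left h3]
      simp [embedBlock, hl]
  rw [← hwk]
  refine hle.trans (le_of_eq ?_)
  congr 1
  ext p
  simp [hAx]

/-- First, (Σ - ν)u = -εBu has norm at most ε‖B‖, and the gap s bounds the part of u outside block k
by ε‖B‖/s. Next, block k of the equation divided by ε says that u_k is an approximate eigenvector of
B_kk for (ν - σ_k)/ε, with residual at most ‖B‖ times that bound; the gap m yields w. -/
lemma exists_near_block_eigenvector {q n : ℕ} {σ : Fin n → ℝ}
    {B : Matrix (Fin n × Fin q) (Fin n × Fin q) ℝ} (hB : B.IsHermitian) {s m : ℝ} (hs : 0 < s)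
    (hm : 0 < m) (hσ : ∀ k l, k ≠ l → 2 * s ≤ |σ k - σ l|)
    (hgap : ∀ k, ∀ a ∈ spectrum ℝ (diagBlock B k), ∀ b ∈ spectrum ℝ (diagBlock B k), a ≠ b →
      2 * m ≤ |a - b|)
    {ε ν : ℝ} (hε : 0 < ε) {u : EuclideanSpace ℝ (Fin n × Fin q)} (hu : ‖u‖ = 1)
    (heq : ∀ p, σ p.1 * u p + ε * (B *ᵥ u.ofLp) p = ν * u p) :
    ∃ (k : Fin n) (w : EuclideanSpace ℝ (Fin q)) (β : ℝ),
      diagBlock B k *ᵥ w.ofLp = β • w.ofLp ∧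
      (∀ c : EuclideanSpace ℝ (Fin q), diagBlock B k *ᵥ c.ofLp = β • c.ofLp →
        inner ℝ c (restrictBlock k u - w) = 0) ∧
      ‖u - embedBlock k w‖ ≤ ε * norm2 B * (m + norm2 B) / (s * m) := by
  have hu0 : u ≠ 0 := by
    rintro rfl
    simp at hu
  obtain ⟨k, hk⟩ := exists_block_projection hs hσ ν hu0
  have h1 : ‖u - embedBlock k (restrictBlock k u)‖ ≤ ε * norm2 B / s := by
    rw [le_div_iff₀ hs, mul_comm]
    refine hk.trans ?_
    have h2 : WithLp.toLp 2 (fun p : Fin n × Fin q => σ p.1 * u p - ν * u p)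
        = (-ε) • WithLp.toLp 2 (B *ᵥ u.ofLp) := by
      ext p
      simp only [PiLp.smul_apply, smul_eq_mul]
      linarith [heq p]
    rw [h2, norm_smul, norm_neg, Real.norm_eq_abs, abs_of_pos hε]
    have := norm_mulVec_le_norm2 B u
    rw [hu, mul_one] at this
    gcongr
  have hBk : (diagBlock B k).IsHermitian := hB.submatrix _
  have : Nonempty (Fin q) := by
    by_contra h
    rw [not_nonempty_iff] at h
    exact hu0 (Subsingleton.elim _ _)
  obtain ⟨i₀, w, hw, horth, hle⟩ := exists_eigenprojection hBk.eigenvectorBasis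
    (toEuclideanLin (𝕜 := ℝ) (diagBlock B k)) hBk.eigenvalues
    (by
      intro i
      ext j
      simpa [toLpLin_apply] using congrFun (hBk.mulVec_eigenvectorBasis i) j)
    hm.le
    (fun i j h => hgap k _ (hBk.eigenvalues_mem_spectrum_real i) _
      (hBk.eigenvalues_mem_spectrum_real j) h)
    ((ν - σ k) / ε) (restrictBlock k u)
  refine ⟨k, w, hBk.eigenvalues i₀, ?_, ?_, ?_⟩
  · have := congrArg WithLp.ofLp hw
    simpa [toLpLin_apply] using this
  · intro c hc
    refine horth c ?_
    ext j
    simpa [toLpLin_apply] using congrFun hc j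
  · have h3 : toEuclideanLin (𝕜 := ℝ) (diagBlock B k) (restrictBlock k u)
        - ((ν - σ k) / ε) • restrictBlock k u
        = -restrictBlock k (WithLp.toLp 2
          (B *ᵥ (u - embedBlock k (restrictBlock k u)).ofLp)) := by
      ext i
      have h4 := heq (k, i)
      simp only [toLpLin_apply, PiLp.sub_apply, PiLp.smul_apply, PiLp.neg_apply, smul_eq_mul,
        WithLp.ofLp_sub, mulVec_sub, restrictBlock, Pi.sub_apply, mulVec_embedBlock] at h4 ⊢
      field_simp
      linarith
    rw [h3, norm_neg] at hle
    have h5 := (norm_restrictBlock_le k (WithLp.toLp 2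
      (B *ᵥ (u - embedBlock k (restrictBlock k u)).ofLp))).trans (norm_mulVec_le_norm2 B _)
    have hb := norm2_nonneg B
    have h6 : ‖restrictBlock k u - w‖ ≤ norm2 B * (ε * norm2 B / s) / m := by
      rw [le_div_iff₀ hm, mul_comm]
      exact (hle.trans h5).trans (mul_le_mul_of_nonneg_left h1 hb)
    calc ‖u - embedBlock k w‖
        = ‖(u - embedBlock k (restrictBlock k u)) + embedBlock k (restrictBlock k u - w)‖ := by
          rw [← embedBlock_sub]
          congr 1
          abel
      _ ≤ ε * norm2 B / s + norm2 B * (ε * norm2 B / s) / m := by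
          refine (norm_add_le _ _).trans (add_le_add h1 ?_)
          rwa [norm_embedBlock]
      _ = _ := by
          field_simp

/-- An undamped mode `u` of the coupled system that is orthogonal to the synchronous motions
cannot escape the damping when the coupling `ε` is small. -/
lemma eq_zero_of_undamped_mode {q n : ℕ} {σ : Fin n → ℝ}
    {G B : Matrix (Fin n × Fin q) (Fin n × Fin q) ℝ} (hB : B.IsHermitian)
    (hG : G.IsHermitian) {s m γ : ℝ}
    (hs : 0 < s) (hm : 0 < m) (hγ : 0 < γ) (hσ : ∀ k l, k ≠ l → 2 * s ≤ |σ k - σ l|)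
    (hgap : ∀ k, ∀ a ∈ spectrum ℝ (diagBlock B k), ∀ b ∈ spectrum ℝ (diagBlock B k), a ≠ b →
      2 * m ≤ |a - b|)
    (hB1 : ∀ k, diagBlock B k *ᵥ 1 = 0)
    (hγG : ∀ (k : Fin n) (w : EuclideanSpace ℝ (Fin q)) (β : ℝ),
      diagBlock B k *ᵥ w.ofLp = β • w.ofLp → ∑ i, w i = 0 →
      γ ^ 2 * ‖w‖ ^ 2 ≤ w.ofLp ⬝ᵥ diagBlock G k *ᵥ w.ofLp)
    {ε ν : ℝ} (hε : 0 < ε)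
    (hsmall : ε * norm2 B * (m + norm2 B) * (√(norm2 G) + γ) < γ * s * m)
    {u : Fin n × Fin q → ℝ} (heq : ∀ p, σ p.1 * u p + ε * (B *ᵥ u) p = ν * u p)
    (hGu : G *ᵥ u = 0) (hu1 : ∀ k, ∑ i, u (k, i) = 0) : u = 0 := by
  by_contra hu0
  wlog hu : ‖WithLp.toLp 2 u‖ = 1 generalizing u with H
  · have hn : 0 < ‖WithLp.toLp 2 u‖ := norm_pos_iff.2 fun h => hu0 (congrArg WithLp.ofLp h)
    refine H (u := ‖WithLp.toLp 2 u‖⁻¹ • u) ?_ ?_ ?_ ?_ ?_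
    · intro p
      rw [mulVec_smul]
      simp only [Pi.smul_apply, smul_eq_mul]
      linear_combination ‖WithLp.toLp 2 u‖⁻¹ * heq p
    · rw [mulVec_smul, hGu, smul_zero]
    · intro k
      simp [← Finset.mul_sum, hu1]
    · exact smul_ne_zero (inv_ne_zero hn.ne') hu0
    · rw [WithLp.toLp_smul, norm_smul, norm_inv, norm_norm, inv_mul_cancel₀ hn.ne']
  obtain ⟨k, w, β, hw, horth, hle⟩ := exists_near_block_eigenvector hB hs hm hσ hgap hε hu heq
  set δ := ε * norm2 B * (m + norm2 B) / (s * m) with hδ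
  set U : EuclideanSpace ℝ (Fin n × Fin q) := WithLp.toLp 2 u with hU
  -- If β = 0, the vector 1 lies in the eigenspace, so u_k - w is orthogonal to it, and u_k has zero
  -- sum. If β ≠ 0, w is orthogonal to the kernel vector 1.
  have hw1 : ∑ i, w i = 0 := by
    by_cases hβ : β = 0
    · have h1 := horth (WithLp.toLp 2 1) (by rw [hβ, zero_smul]; exact hB1 k)
      rw [EuclideanSpace.inner_eq_star_dotProduct] at h1
      simp only [star_trivial, dotProduct_one, WithLp.ofLp_sub, Pi.sub_apply,
        Finset.sum_sub_distrib] at h1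
      have h2 : ∑ i, restrictBlock k U i = 0 := hu1 k
      linarith
    · exact sum_eq_zero_of_mulVec_eq (hB.submatrix fun i => (k, i)) (hB1 k) hw hβ
  have h1 := hγG k w β hw hw1
  -- Since Gu = 0 and G is symmetric, the form of G does not see the shift of the embedded w by u.
  have h2 : w.ofLp ⬝ᵥ diagBlock G k *ᵥ w.ofLp
      = (U - embedBlock k w).ofLp ⬝ᵥ G *ᵥ (U - embedBlock k w).ofLp := by
    have h3 : U.ofLp ⬝ᵥ G *ᵥ (embedBlock k w).ofLp = 0 := by
      rw [dotProduct_mulVec_comm_of_isHermitian hG]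
      change _ ⬝ᵥ G *ᵥ u = 0
      rw [hGu, dotProduct_zero]
    have h4 : G *ᵥ U.ofLp = 0 := hGu
    rw [WithLp.ofLp_sub, mulVec_sub, h4, zero_sub, dotProduct_neg, sub_dotProduct, h3, zero_sub,
      neg_neg, dotProduct_embedBlock]
    congr 1
    ext i
    rw [mulVec_embedBlock]
  have h3 := dotProduct_mulVec_le_norm2 G (U - embedBlock k w)
  have hg := norm2_nonneg G
  have h4 : γ * ‖w‖ ≤ √(norm2 G) * δ := by
    refine le_of_sq_le_sq ?_ (mul_nonneg (Real.sqrt_nonneg _) ((norm_nonneg _).trans hle))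
    rw [mul_pow, mul_pow, Real.sq_sqrt hg]
    calc _ ≤ _ := h1
      _ = _ := h2
      _ ≤ _ := h3
      _ ≤ _ := by gcongr
  have h5 : 1 ≤ ‖w‖ + δ := by
    calc (1 : ℝ) = ‖embedBlock k w + (U - embedBlock k w)‖ := by rw [add_sub_cancel, hu]
      _ ≤ ‖embedBlock k w‖ + ‖U - embedBlock k w‖ := norm_add_le _ _
      _ ≤ _ := by rw [norm_embedBlock]; gcongr
  have h6 : δ * (√(norm2 G) + γ) < γ := by
    rw [hδ, div_mul_eq_mul_div, div_lt_iff₀ (mul_pos hs hm)]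
    linarith
  -- γ ≤ γ‖w‖ + γδ ≤ (√‖G‖ + γ)δ < γ.
  nlinarith

/-! ### The inverse square root of the mass matrix -/

section MatrixOrder
open scoped MatrixOrder

lemma sqrt_posSemidef {n : ℕ} (M : Matrix (Fin n) (Fin n) ℝ) : (CFC.sqrt M).PosSemidef :=
  nonneg_iff_posSemidef.1 (CFC.sqrt_nonneg M)

lemma sqrt_mul_sqrt {n : ℕ} {M : Matrix (Fin n) (Fin n) ℝ} (hM : M.PosDef) :
    CFC.sqrt M * CFC.sqrt M = M :=
  CFC.sqrt_mul_sqrt_self M hM.posSemidef.nonneg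

lemma isUnit_det_sqrt {n : ℕ} {M : Matrix (Fin n) (Fin n) ℝ} (hM : M.PosDef) :
    IsUnit (CFC.sqrt M).det := by
  rw [isUnit_iff_ne_zero]
  intro h
  have h1 := congrArg Matrix.det (sqrt_mul_sqrt hM)
  rw [det_mul, h, zero_mul] at h1
  exact hM.det_pos.ne h1

lemma exists_sqrt {n : ℕ} {M : Matrix (Fin n) (Fin n) ℝ} (hM : M.PosDef) :
    ∃ T : Matrix (Fin n) (Fin n) ℝ, T.IsHermitian ∧ (invSqrt M).IsHermitian ∧
      T * T = M ∧ T * invSqrt M = 1 ∧ invSqrt M * T = 1 :=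
  ⟨CFC.sqrt M, (sqrt_posSemidef M).1, (sqrt_posSemidef M).1.inv, sqrt_mul_sqrt hM,
    mul_nonsing_inv _ (isUnit_det_sqrt hM), nonsing_inv_mul _ (isUnit_det_sqrt hM)⟩

end MatrixOrder

lemma isHermitian_mul_mul {n : ℕ} {S X : Matrix (Fin n) (Fin n) ℝ} (hS : S.IsHermitian)
    (hX : X.IsHermitian) : (S * X * S).IsHermitian := by
  have := isHermitian_conjTranspose_mul_mul S hX
  rwa [hS.eq] at this

lemma posSemidef_mul_mul {n : ℕ} {S X : Matrix (Fin n) (Fin n) ℝ} (hS : S.IsHermitian)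
    (hX : X.PosSemidef) : (S * X * S).PosSemidef := by
  have := hX.conjTranspose_mul_mul_same S
  rwa [hS.eq] at this

/-! ### Matrix-weighted Laplacians -/

lemma lap_mulVec {q n : ℕ} {W : Fin q → Fin q → Matrix (Fin n) (Fin n) ℝ}
    (hW : ∀ i, W i i = 0) (x : Fin q × Fin n → ℝ) (i : Fin q) (a : Fin n) :
    (lap W *ᵥ x) (i, a) = (∑ j, W i j *ᵥ ((fun b => x (i, b)) - fun b => x (j, b))) a := by
  -- Because W i i = 0, the off-diagonal term may also be subtracted at j = i.
  have h1 : ∀ j, ∑ b, lap W (i, a) (j, b) * x (j, b)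
      = (if i = j then ((∑ l, W i l) *ᵥ fun b => x (i, b)) a else 0)
        - (W i j *ᵥ fun b => x (j, b)) a := by
    intro j
    by_cases h : i = j
    · subst h
      simp [lap, hW, mulVec, dotProduct]
    · simp [lap, h, mulVec, dotProduct]
  simp only [mulVec, dotProduct, Fintype.sum_prod_type]
  rw [Finset.sum_congr rfl fun j _ => h1 j, Finset.sum_sub_distrib]
  simp only [Finset.sum_ite_eq, Finset.mem_univ, if_true, Finset.sum_apply, sum_mulVec]
  rw [← Finset.sum_sub_distrib]
  refine Finset.sum_congr rfl fun j _ => ?_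
  rw [← Pi.sub_apply, ← mulVec_sub]

/-- Symmetrizing over (i, j) gives 2xᵀLx = ∑ (y_i - y_j)ᵀ W_ij (y_i - y_j), with y_i the blocks of
x. -/
lemma lap_posSemidef {q n : ℕ} {W : Fin q → Fin q → Matrix (Fin n) (Fin n) ℝ}
    (hW : ∀ i j, (W i j).PosSemidef) (hsymm : ∀ i j, W i j = W j i) (hW0 : ∀ i, W i i = 0) :
    (lap W).PosSemidef := by
  have hherm : (lap W).IsHermitian := by
    ext ⟨i, a⟩ ⟨j, b⟩
    rw [conjTranspose_apply, star_trivial]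
    by_cases h : i = j
    · subst h
      have : (∑ l, W i l).IsHermitian := isSelfAdjoint_sum _ fun l _ => (hW i l).1
      simpa [lap] using this.apply a b
    · have := (hW i j).1.apply a b
      simp only [star_trivial] at this
      simp [lap, h, Ne.symm h, hsymm j i, this]
  refine .of_dotProduct_mulVec_nonneg hherm fun x => ?_
  rw [star_trivial]
  set y : Fin q → Fin n → ℝ := fun i b => x (i, b) with hy
  have h1 : x ⬝ᵥ lap W *ᵥ x = ∑ i, ∑ j, y i ⬝ᵥ W i j *ᵥ (y i - y j) := by
    simp only [dotProduct, Fintype.sum_prod_type, lap_mulVec hW0, Finset.sum_apply,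
      Finset.mul_sum]
    refine Finset.sum_congr rfl fun i _ => ?_
    rw [Finset.sum_comm]
  have h2 : x ⬝ᵥ lap W *ᵥ x = ∑ i, ∑ j, -(y j ⬝ᵥ W i j *ᵥ (y i - y j)) := by
    rw [h1, Finset.sum_comm]
    refine Finset.sum_congr rfl fun i _ => Finset.sum_congr rfl fun j _ => ?_
    rw [hsymm j i, ← neg_sub (y i), mulVec_neg, dotProduct_neg]
  have h3 : 0 ≤ ∑ i, ∑ j, (y i - y j) ⬝ᵥ W i j *ᵥ (y i - y j) :=
    Finset.sum_nonneg fun i _ => Finset.sum_nonneg fun j _ => by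
      simpa using (hW i j).dotProduct_mulVec_nonneg (y i - y j)
  have h4 : 2 * (x ⬝ᵥ lap W *ᵥ x) = ∑ i, ∑ j, (y i - y j) ⬝ᵥ W i j *ᵥ (y i - y j) := by
    rw [two_mul]
    nth_rw 1 [h1]
    rw [h2, ← Finset.sum_add_distrib]
    refine Finset.sum_congr rfl fun i _ => ?_
    rw [← Finset.sum_add_distrib]
    refine Finset.sum_congr rfl fun j _ => ?_
    rw [sub_dotProduct]
    ring
  linarith

/-! ### Modal coordinates -/

/-- The matrix with the columns `v₁, …, v_n`. -/
def modeMatrix {n : ℕ} (v : Fin n → EuclideanSpace ℝ (Fin n)) : Matrix (Fin n) (Fin n) ℝ :=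
  Matrix.of fun a k => v k a

lemma modeMatrix_orthogonal {n : ℕ} {P : Matrix (Fin n) (Fin n) ℝ} (hP : P.IsHermitian)
    {σ : Fin n → ℝ} {v : Fin n → EuclideanSpace ℝ (Fin n)} (hσ : Function.Injective σ)
    (hv : ∀ k, ‖v k‖ = 1) (hPv : ∀ k, P *ᵥ (v k).ofLp = σ k • (v k).ofLp) :
    (modeMatrix v)ᵀ * modeMatrix v = 1 := by
  ext k l
  have h1 : ((modeMatrix v)ᵀ * modeMatrix v) k l = (v k).ofLp ⬝ᵥ (v l).ofLp := rfl
  rw [h1]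
  by_cases h : k = l
  · subst h
    have h2 := real_inner_self_eq_norm_sq (v k)
    rw [EuclideanSpace.inner_eq_star_dotProduct, hv, star_trivial] at h2
    simpa using h2
  · rw [one_apply_ne h]
    have h2 := dotProduct_mulVec_comm_of_isHermitian hP (v k).ofLp (v l).ofLp
    rw [hPv, hPv, dotProduct_smul, dotProduct_smul, dotProduct_comm (v l).ofLp] at h2
    have h3 : (σ l - σ k) * ((v k).ofLp ⬝ᵥ (v l).ofLp) = 0 := by
      simp only [smul_eq_mul] at h2
      linarith
    exact (mul_eq_zero.1 h3).resolve_left (sub_ne_zero.2 (hσ.ne (Ne.symm h)))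

/-- The matrix that maps modal coordinates to the stacked coordinates of all oscillators. -/
def stackedModes (q : ℕ) {n : ℕ} (v : Fin n → EuclideanSpace ℝ (Fin n)) :
    Matrix (Fin q × Fin n) (Fin n × Fin q) ℝ :=
  Matrix.of fun p r => idKron q (v r.1) p r.2

lemma modalMatrix_eq {q n : ℕ} (L : Matrix (Fin q × Fin n) (Fin q × Fin n) ℝ)
    (v : Fin n → EuclideanSpace ℝ (Fin n)) :
    modalMatrix L v = (stackedModes q v)ᵀ * L * stackedModes q v := rfl

lemma modalMatrix_posSemidef {q n : ℕ} {L : Matrix (Fin q × Fin n) (Fin q × Fin n) ℝ}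
    (hL : L.PosSemidef) (v : Fin n → EuclideanSpace ℝ (Fin n)) :
    (modalMatrix L v).PosSemidef := by
  rw [modalMatrix_eq, ← conjTranspose_eq_transpose_of_trivial]
  exact hL.conjTranspose_mul_mul_same _

lemma stackedModes_mulVec {q n : ℕ} (v : Fin n → EuclideanSpace ℝ (Fin n))
    (z : Fin n × Fin q → ℝ) (i : Fin q) :
    (fun a => (stackedModes q v *ᵥ z) (i, a)) = modeMatrix v *ᵥ fun l => z (l, i) := by
  ext a
  simp only [stackedModes, idKron, modeMatrix, mulVec, dotProduct, of_apply,
    Fintype.sum_prod_type]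
  refine Finset.sum_congr rfl fun l _ => ?_
  simp [one_apply]

lemma stackedModes_transpose_mulVec {q n : ℕ} (v : Fin n → EuclideanSpace ℝ (Fin n))
    (x : Fin q × Fin n → ℝ) (k : Fin n) (i : Fin q) :
    ((stackedModes q v)ᵀ *ᵥ x) (k, i) = (v k).ofLp ⬝ᵥ fun a => x (i, a) := by
  simp only [stackedModes, idKron, mulVec, dotProduct, transpose_apply, of_apply,
    Fintype.sum_prod_type]
  rw [Finset.sum_eq_single i]
  · simp
  · intro j _ hj
    simp [one_apply, hj]
  · simp

lemma modalMatrix_lap_mulVec {q n : ℕ} {W : Fin q → Fin q → Matrix (Fin n) (Fin n) ℝ}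
    (hW : ∀ i, W i i = 0) (v : Fin n → EuclideanSpace ℝ (Fin n)) (z : Fin n × Fin q → ℝ)
    (k : Fin n) (i : Fin q) :
    (modalMatrix (lap W) v *ᵥ z) (k, i) = (v k).ofLp ⬝ᵥ
      ∑ j, W i j *ᵥ ((modeMatrix v *ᵥ fun l => z (l, i)) - modeMatrix v *ᵥ fun l => z (l, j)) := by
  rw [modalMatrix_eq, ← mulVec_mulVec, ← mulVec_mulVec, stackedModes_transpose_mulVec]
  congr 1
  ext a
  rw [lap_mulVec hW]
  simp only [stackedModes_mulVec]

lemma modalMatrix_lap_mulVec_eq_zero {q n : ℕ} {W : Fin q → Fin q → Matrix (Fin n) (Fin n) ℝ}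
    (hW : ∀ i, W i i = 0) (v : Fin n → EuclideanSpace ℝ (Fin n)) (c : Fin n → ℝ) :
    modalMatrix (lap W) v *ᵥ (fun p => c p.1) = 0 := by
  ext ⟨k, i⟩
  rw [modalMatrix_lap_mulVec hW]
  simp

lemma diagBlock_mulVec_one {q n : ℕ} {X : Matrix (Fin n × Fin q) (Fin n × Fin q) ℝ}
    (hX : ∀ c : Fin n → ℝ, X *ᵥ (fun p => c p.1) = 0) (k : Fin n) :
    diagBlock X k *ᵥ 1 = 0 := by
  ext i
  have h1 := congrFun (hX fun l => if l = k then 1 else 0) (k, i)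
  have h2 := mulVec_embedBlock X k (WithLp.toLp 2 1) i
  exact h2.symm.trans h1

/-! ### Synchronization in modal coordinates -/

/-- The block sums of a vector of `ℝⁿ ⊗ ℝ^q`. -/
def blockSum (q n : ℕ) : Matrix (Fin n) (Fin n × Fin q) ℝ :=
  Matrix.of fun k p => if p.1 = k then 1 else 0

lemma blockSum_mulVec {q n : ℕ} (f : Fin n × Fin q → ℝ) (k : Fin n) :
    (blockSum q n *ᵥ f) k = ∑ i, f (k, i) := by
  simp only [blockSum, mulVec, dotProduct, of_apply, Fintype.sum_prod_type]
  rw [Finset.sum_eq_single k]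
  · simp
  · intro l _ hl
    simp [hl]
  · simp

lemma sum_block_mulVec_eq_zero {q n : ℕ} {X : Matrix (Fin n × Fin q) (Fin n × Fin q) ℝ}
    (hX : X.IsHermitian) (hX1 : ∀ c : Fin n → ℝ, X *ᵥ (fun p => c p.1) = 0)
    (f : Fin n × Fin q → ℝ) (k : Fin n) : ∑ i, (X *ᵥ f) (k, i) = 0 := by
  have h1 : ∑ i, (X *ᵥ f) (k, i)
      = (fun p : Fin n × Fin q => if p.1 = k then (1 : ℝ) else 0) ⬝ᵥ X *ᵥ f := by
    rw [← blockSum_mulVec]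
    rfl
  rw [h1, dotProduct_mulVec_comm_of_isHermitian hX, hX1 fun l => if l = k then 1 else 0,
    dotProduct_zero]

/-- Block averages obey undamped equations and need not decay, so they are subtracted; G and B do
not see them. To apply the stability theorem on the whole space, EᵀE is added to the damping, with E
the block sums: it vanishes on centred vectors and makes the modes with nonzero block sums
observable. -/
theorem tendsto_sub_of_modal_equation {q n : ℕ} {σ : Fin n → ℝ} (hσ : ∀ k, 0 < σ k)
    {G B : Matrix (Fin n × Fin q) (Fin n × Fin q) ℝ} (hG : G.PosSemidef) (hB : B.PosSemidef)
    (hG1 : ∀ c : Fin n → ℝ, G *ᵥ (fun p => c p.1) = 0)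
    (hB1 : ∀ c : Fin n → ℝ, B *ᵥ (fun p => c p.1) = 0) {ε : ℝ} (hε : 0 < ε)
    (hobs : ∀ (ν : ℝ) (u : Fin n × Fin q → ℝ),
      (∀ p, σ p.1 * u p + ε * (B *ᵥ u) p = ν * u p) → G *ᵥ u = 0 →
      (∀ k, ∑ i, u (k, i) = 0) → u = 0)
    (z w a : ℝ → Fin n × Fin q → ℝ)
    (hz : ∀ t ∈ Set.Ici (0 : ℝ), ∀ p, HasDerivWithinAt (fun t => z t p) (w t p) (Set.Ici 0) t)
    (hw : ∀ t ∈ Set.Ici (0 : ℝ), ∀ p, HasDerivWithinAt (fun t => w t p) (a t p) (Set.Ici 0) t)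
    (heq : ∀ t ∈ Set.Ici (0 : ℝ), ∀ p,
      a t p + σ p.1 * z t p + (G *ᵥ w t) p + ε * (B *ᵥ z t) p = 0) (k : Fin n) (i j : Fin q) :
    Tendsto (fun t => z t (k, i) - z t (k, j)) atTop (𝓝 0) := by
  set E := blockSum q n
  set ctr : (Fin n × Fin q → ℝ) → Fin n × Fin q → ℝ :=
    fun f p => f p - (∑ j, f (p.1, j)) / q with hctr
  have hq : (q : ℝ) ≠ 0 := by
    have := i.pos
    positivity
  have hctr0 : ∀ f k, ∑ i, ctr f (k, i) = 0 := by
    intro f k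
    simp only [hctr, Finset.sum_sub_distrib, Finset.sum_const, Finset.card_univ,
      Fintype.card_fin, nsmul_eq_mul]
    field_simp
    ring
  have hXc : ∀ X : Matrix (Fin n × Fin q) (Fin n × Fin q) ℝ,
      (∀ c : Fin n → ℝ, X *ᵥ (fun p => c p.1) = 0) → ∀ f, X *ᵥ ctr f = X *ᵥ f := by
    intro X hX f
    have : ctr f = f - fun p => (fun k => (∑ j, f (k, j)) / q) p.1 := rfl
    rw [this, mulVec_sub, hX fun k => (∑ j, f (k, j)) / q, sub_zero]
  have hEE : (Eᵀ * E).PosSemidef := by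
    rw [← conjTranspose_eq_transpose_of_trivial]
    exact posSemidef_conjTranspose_mul_self E
  have hH : (diagonal (fun p : Fin n × Fin q => σ p.1) + ε • B).PosDef :=
    (posDef_diagonal_iff.2 fun p => hσ p.1).add_posSemidef (hB.smul hε.le)
  have hderiv : ∀ f g : ℝ → Fin n × Fin q → ℝ, (∀ t ∈ Set.Ici (0 : ℝ), ∀ p,
      HasDerivWithinAt (fun t => f t p) (g t p) (Set.Ici 0) t) →
      ∀ t ∈ Set.Ici (0 : ℝ),
        HasDerivWithinAt (fun t => ctr (f t)) (ctr (g t)) (Set.Ici 0) t := by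
    intro f g hfg t ht
    rw [hasDerivWithinAt_pi]
    intro p
    exact (hfg t ht p).sub
      ((HasDerivWithinAt.fun_sum fun j _ => hfg t ht (p.1, j)).div_const _)
  have key := tendsto_zero_of_observable hH (hG.add hEE) ?_ (fun t => ctr (z t))
    (fun t => ctr (w t)) (fun t => ctr (a t)) (hderiv z w hz) (hderiv w a hw) ?_
  · rw [tendsto_pi_nhds] at key
    have := (key (k, i)).sub (key (k, j))
    simpa [hctr] using this
  · intro ν u hu hGu
    have h1 : u ⬝ᵥ G *ᵥ u + u ⬝ᵥ (Eᵀ * E) *ᵥ u = 0 := by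
      rw [← dotProduct_add, ← add_mulVec, hGu, dotProduct_zero]
    have h2 := hG.dotProduct_mulVec_nonneg u
    have h3 := hEE.dotProduct_mulVec_nonneg u
    rw [star_trivial] at h2 h3
    have hGu0 : G *ᵥ u = 0 := mulVec_eq_zero_of_dotProduct_eq_zero hG (by linarith)
    have hEu : E *ᵥ u = 0 := by
      have h4 : u ⬝ᵥ (Eᵀ * E) *ᵥ u = 0 := by linarith
      rw [← mulVec_mulVec, dotProduct_mulVec, vecMul_transpose] at h4
      exact dotProduct_self_eq_zero.1 h4
    refine hobs ν u (fun p => ?_) hGu0 fun k => ?_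
    · have := congrFun hu p
      simpa [add_mulVec, smul_mulVec, mulVec_diagonal] using this
    · rw [← blockSum_mulVec]
      exact congrFun hEu k
  · intro t ht
    have hE0 : E *ᵥ ctr (w t) = 0 := by
      ext k
      rw [blockSum_mulVec, hctr0]
      rfl
    ext p
    simp only [add_mulVec, smul_mulVec, ← mulVec_mulVec, hE0, mulVec_zero, hXc G hG1, hXc B hB1,
      Pi.add_apply, Pi.smul_apply, smul_eq_mul, mulVec_diagonal, add_zero, Pi.zero_apply]
    have h1 := heq t ht p
    have h2 : ∑ j, a t (p.1, j) + σ p.1 * ∑ j, z t (p.1, j) = 0 := by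
      have h3 : ∑ j, (a t (p.1, j) + σ p.1 * z t (p.1, j) + (G *ᵥ w t) (p.1, j)
          + ε * (B *ᵥ z t) (p.1, j)) = 0 := Finset.sum_eq_zero fun j _ => heq t ht (p.1, j)
      simpa only [Finset.sum_add_distrib, ← Finset.mul_sum,
        sum_block_mulVec_eq_zero hG.1 hG1, sum_block_mulVec_eq_zero hB.1 hB1, mul_zero,
        add_zero] using h3
    simp only [hctr]
    -- The equation minus its block average.
    linear_combination h1 - h2 / q

/-! ### Modal data of the array -/

lemma couplingLap_posSemidef {q n : ℕ} {M : Matrix (Fin n) (Fin n) ℝ} (hM : M.PosDef)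
    {W : Fin q → Fin q → Matrix (Fin n) (Fin n) ℝ} (hW : ∀ i j, (W i j).PosSemidef)
    (hsymm : ∀ i j, W i j = W j i) (hdiag : ∀ i, W i i = 0) :
    (couplingLap M W).PosSemidef := by
  obtain ⟨T, -, hS, -, -, -⟩ := exists_sqrt hM
  exact lap_posSemidef (fun i j => posSemidef_mul_mul hS (hW i j))
    (fun i j => by rw [hsymm i j]) (fun i => by simp [hdiag])

lemma modalMatrix_couplingLap_mulVec_eq_zero {q n : ℕ} (M : Matrix (Fin n) (Fin n) ℝ)
    {W : Fin q → Fin q → Matrix (Fin n) (Fin n) ℝ} (hdiag : ∀ i, W i i = 0)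
    (v : Fin n → EuclideanSpace ℝ (Fin n)) (c : Fin n → ℝ) :
    modalMatrix (couplingLap M W) v *ᵥ (fun p => c p.1) = 0 :=
  modalMatrix_lap_mulVec_eq_zero (fun i => by simp [hdiag]) v c

lemma eigenvalue_normalizedStiffness_pos {n : ℕ} {M K : Matrix (Fin n) (Fin n) ℝ}
    (hM : M.PosDef) (hK : K.PosDef) {x : EuclideanSpace ℝ (Fin n)} (hx : ‖x‖ = 1) {c : ℝ}
    (hc : normalizedStiffness M K *ᵥ x.ofLp = c • x.ofLp) : 0 < c := by
  obtain ⟨T, -, hS, -, hTS, -⟩ := exists_sqrt hM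
  have h1 : invSqrt M *ᵥ x.ofLp ≠ 0 := by
    intro h
    have h2 : x.ofLp = 0 := by
      rw [← one_mulVec x.ofLp, ← hTS, ← mulVec_mulVec, h, mulVec_zero]
    have : x = 0 := by ext i; exact congrFun h2 i
    simp [this] at hx
  have h3 := hK.dotProduct_mulVec_pos h1
  have h4 : x.ofLp ⬝ᵥ normalizedStiffness M K *ᵥ x.ofLp
      = (invSqrt M *ᵥ x.ofLp) ⬝ᵥ K *ᵥ (invSqrt M *ᵥ x.ofLp) := by
    rw [normalizedStiffness, ← mulVec_mulVec, ← mulVec_mulVec,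
      dotProduct_mulVec_comm_of_isHermitian hS, dotProduct_comm]
  have h5 : x.ofLp ⬝ᵥ x.ofLp = 1 := by
    have := real_inner_self_eq_norm_sq x
    rw [EuclideanSpace.inner_eq_star_dotProduct, star_trivial, hx] at this
    simpa using this
  rw [star_trivial, ← h4, hc, dotProduct_smul, h5] at h3
  simpa using h3

/-- For i ≠ j, entry (i, j) of B_kk is -v_kᵀ W v_k with W = M^{-1/2} R_ij M^{-1/2}. If these vanish
for all k, semidefiniteness gives W v_k = 0; the v_k span, so W = 0 and R_ij = 0. -/
lemma exists_diagBlock_ne_zero {q n : ℕ} {M : Matrix (Fin n) (Fin n) ℝ} (hM : M.PosDef)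
    {R : Fin q → Fin q → Matrix (Fin n) (Fin n) ℝ} (hR : ∀ i j, (R i j).PosSemidef)
    (hRdiag : ∀ i, R i i = 0) (hRne : ∃ i j, R i j ≠ 0)
    {v : Fin n → EuclideanSpace ℝ (Fin n)} (hV : modeMatrix v * (modeMatrix v)ᵀ = 1) :
    ∃ k, diagBlock (modalMatrix (couplingLap M R) v) k ≠ 0 := by
  by_contra! h
  obtain ⟨T, -, hS, -, hTS, hST⟩ := exists_sqrt hM
  obtain ⟨i, j, hij⟩ := hRne
  have hne : i ≠ j := by
    rintro rfl
    exact hij (hRdiag i)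
  set W := invSqrt M * R i j * invSqrt M with hW
  have hWpsd : W.PosSemidef := posSemidef_mul_mul hS (hR i j)
  have h1 : ∀ k, W *ᵥ (v k).ofLp = 0 := by
    intro k
    refine mulVec_eq_zero_of_dotProduct_eq_zero hWpsd ?_
    have h2 := congrFun (congrFun (h k) i) j
    have h3 := mulVec_embedBlock (modalMatrix (couplingLap M R) v) k
      (EuclideanSpace.single j 1) i
    rw [couplingLap, modalMatrix_lap_mulVec (fun i => by simp [hRdiag])] at h3
    have h4 : ∀ l,
        (modeMatrix v *ᵥ fun m => (embedBlock k (EuclideanSpace.single j (1 : ℝ))) (m, l)) = if l = j then (v k).ofLp else 0 := by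
      intro l
      ext a
      by_cases hl : l = j
      · simp [hl, embedBlock, mulVec, dotProduct, modeMatrix]
      · simp [hl, embedBlock, mulVec, dotProduct]
    simp only [h4, if_neg hne] at h3
    rw [Finset.sum_eq_single j] at h3
    · rw [if_pos rfl, zero_sub, mulVec_neg, dotProduct_neg] at h3
      have h5 : (diagBlock (modalMatrix (couplingLap M R) v) k
          *ᵥ (EuclideanSpace.single j (1 : ℝ)).ofLp) i = 0 := by
        rw [h k]
        simp
      have h6 := h3.trans h5
      linarith
    · intro l _ hl
      simp [hl]
    · simp
  have h2 : W * modeMatrix v = 0 := by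
    ext a k
    exact congrFun (h1 k) a
  have h3 : W = 0 := by
    rw [← mul_one W, ← hV, ← mul_assoc, h2, zero_mul]
  refine hij ?_
  calc R i j = (T * invSqrt M) * R i j * (invSqrt M * T) := by rw [hTS, hST, one_mul, mul_one]
    _ = T * W * T := by rw [hW]; simp only [mul_assoc]
    _ = 0 := by rw [h3, mul_zero, zero_mul]

lemma mem_spectrum_of_mulVec_eq {q : ℕ} {X : Matrix (Fin q) (Fin q) ℝ} {w : Fin q → ℝ}
    (hw : w ≠ 0) {c : ℝ} (hc : X *ᵥ w = c • w) : c ∈ spectrum ℝ X := by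
  rw [← spectrum_toLin']
  exact (Module.End.hasEigenvalue_of_hasEigenvector (x := w)
    ⟨Module.End.mem_eigenspace_iff.2 (by simpa using hc), hw⟩).mem_spectrum

/-- A nonzero eigenvalue exists besides the eigenvalue 0 of the vector 1, and its eigenvectors have
zero sum. This makes the sets defining μ̄ and γ̄ nonempty. -/
lemma exists_spectrum_ne_and_unitEigenvectors_nonempty {q : ℕ} {X : Matrix (Fin q) (Fin q) ℝ}
    (hX : X.IsHermitian) (hX1 : X *ᵥ 1 = 0) (hX0 : X ≠ 0) :
    (∃ a ∈ spectrum ℝ X, ∃ b ∈ spectrum ℝ X, a ≠ b) ∧ (unitEigenvectors X).Nonempty := by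
  obtain ⟨w, c, hc0, hw0, hw⟩ := hX.exists_eigenvector_of_ne_zero hX0
  have h1 : (1 : Fin q → ℝ) ≠ 0 := by
    intro h
    refine hw0 (funext fun i => ?_)
    have := congrFun h i
    simp at this
  refine ⟨⟨c, mem_spectrum_of_mulVec_eq hw0 hw, 0,
    mem_spectrum_of_mulVec_eq h1 (by rw [hX1, zero_smul]), hc0⟩, ?_⟩
  have hn : 0 < ‖WithLp.toLp 2 w‖ := norm_pos_iff.2 fun h => hw0 (congrArg WithLp.ofLp h)
  refine ⟨_, ofReal_mem_unitEigenvectors (w := ‖WithLp.toLp 2 w‖⁻¹ • WithLp.toLp 2 w) (μ := c)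
    ?_ ?_ ?_⟩
  · rw [norm_smul, norm_inv, norm_norm, inv_mul_cancel₀ hn.ne']
  · rw [WithLp.ofLp_smul, mulVec_smul]
    change _ • X *ᵥ w = _
    rw [hw, smul_comm]
  · simp [← Finset.mul_sum, sum_eq_zero_of_mulVec_eq hX hX1 hw hc0]

theorem synchronizes_of_modal_observable {q n : ℕ} {M K : Matrix (Fin n) (Fin n) ℝ}
    {D R : Fin q → Fin q → Matrix (Fin n) (Fin n) ℝ} (hM : M.PosDef) (hK : K.PosDef)
    (hD : ∀ i j, (D i j).PosSemidef) (hDsymm : ∀ i j, D i j = D j i) (hDdiag : ∀ i, D i i = 0)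
    (hR : ∀ i j, (R i j).PosSemidef) (hRsymm : ∀ i j, R i j = R j i) (hRdiag : ∀ i, R i i = 0)
    {σ : Fin n → ℝ} {v : Fin n → EuclideanSpace ℝ (Fin n)}
    (hV : modeMatrix v * (modeMatrix v)ᵀ = 1) (hv : ∀ k, ‖v k‖ = 1)
    (hPv : ∀ k, normalizedStiffness M K *ᵥ (v k).ofLp = σ k • (v k).ofLp) {ε : ℝ} (hε : 0 < ε)
    (hobs : ∀ (ν : ℝ) (u : Fin n × Fin q → ℝ),
      (∀ p, σ p.1 * u p + ε * (modalMatrix (couplingLap M R) v *ᵥ u) p = ν * u p) →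
      modalMatrix (couplingLap M D) v *ᵥ u = 0 → (∀ k, ∑ i, u (k, i) = 0) → u = 0) :
    Synchronizes M K D (fun i j => ε • R i j) := by
  obtain ⟨T, hT, hS, hTT, hTS, hST⟩ := exists_sqrt hM
  rintro x ⟨x', x'', hx⟩ i j
  set V := modeMatrix v
  set S := invSqrt M with hSdef
  have hSM : S * M = T := by rw [← hTT, ← mul_assoc, hST, one_mul]
  -- Modal coordinates Vᵀ M^{1/2} y_i, used alike for x and its two derivatives; M^{-1/2} V inverts
  -- them.
  set ζ : (Fin q → ℝ → EuclideanSpace ℝ (Fin n)) → ℝ → Fin n × Fin q → ℝ :=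
    fun y t p => (v p.1).ofLp ⬝ᵥ T *ᵥ (y p.2 t).ofLp with hζ
  have hζV : ∀ y t i, V *ᵥ (fun l => ζ y t (l, i)) = T *ᵥ (y i t).ofLp := by
    intro y t i
    have : (fun l => ζ y t (l, i)) = Vᵀ *ᵥ (T *ᵥ (y i t).ofLp) := rfl
    rw [this, mulVec_mulVec, hV, one_mulVec]
  have hζinv : ∀ y t i, (y i t).ofLp = S *ᵥ V *ᵥ (fun l => ζ y t (l, i)) := by
    intro y t i
    rw [hζV, mulVec_mulVec, hST, one_mulVec]
  have hderiv : ∀ y y' : Fin q → ℝ → EuclideanSpace ℝ (Fin n),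
      (∀ i, ∀ t ∈ Set.Ici (0 : ℝ), HasDerivWithinAt (y i) (y' i t) (Set.Ici 0) t) →
      ∀ t ∈ Set.Ici (0 : ℝ), ∀ p,
        HasDerivWithinAt (fun t => ζ y t p) (ζ y' t p) (Set.Ici 0) t := by
    intro y y' hy t ht p
    have hin : ∀ y : Fin q → ℝ → EuclideanSpace ℝ (Fin n), ∀ t,
        ζ y t p = innerSL ℝ (WithLp.toLp 2 (T *ᵥ (v p.1).ofLp)) (y p.2 t) := by
      intro y t
      rw [innerSL_apply_apply, EuclideanSpace.inner_eq_star_dotProduct, star_trivial, hζ]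
      exact dotProduct_mulVec_comm_of_isHermitian hT _ _
    simp only [hin]
    exact (innerSL ℝ (WithLp.toLp 2 (T *ᵥ (v p.1).ofLp))).hasFDerivAt.comp_hasDerivWithinAt t
      (hy p.2 t ht)
  have hcoup : ∀ (W : Fin q → Fin q → Matrix (Fin n) (Fin n) ℝ), (∀ i, W i i = 0) →
      ∀ y t p, (modalMatrix (couplingLap M W) v *ᵥ ζ y t) p
        = (v p.1).ofLp ⬝ᵥ S *ᵥ ∑ j, W p.2 j *ᵥ (y p.2 t - y j t).ofLp := by
    rintro W hW y t ⟨k, i⟩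
    rw [couplingLap, modalMatrix_lap_mulVec (fun i => by simp [hW]), mulVec_sum]
    congr 1
    refine Finset.sum_congr rfl fun j _ => ?_
    change _ *ᵥ (V *ᵥ _ - V *ᵥ _) = _
    rw [hζV, hζV, ← mulVec_sub, mulVec_mulVec, mul_assoc, hST, mul_one, ← mulVec_mulVec]
    rfl
  have key := fun k => tendsto_sub_of_modal_equation
    (fun k => eigenvalue_normalizedStiffness_pos hM hK (hv k) (hPv k))
    (modalMatrix_posSemidef (couplingLap_posSemidef hM hD hDsymm hDdiag) v)
    (modalMatrix_posSemidef (couplingLap_posSemidef hM hR hRsymm hRdiag) v)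
    (modalMatrix_couplingLap_mulVec_eq_zero M hDdiag v)
    (modalMatrix_couplingLap_mulVec_eq_zero M hRdiag v) hε hobs (ζ x) (ζ x') (ζ x'')
    (hderiv x x' fun i t ht => (hx i t ht).1) (hderiv x' x'' fun i t ht => (hx i t ht).2.1)
    (by
      rintro t ht ⟨k, i⟩
      rw [hcoup D hDdiag, hcoup R hRdiag]
      have h1 := congrArg (fun y => (v k).ofLp ⬝ᵥ S *ᵥ y) (hx i t ht).2.2
      simp only [mulVec_add, dotProduct_add, mulVec_zero, dotProduct_zero, smul_mulVec,
        ← Finset.smul_sum, mulVec_smul, dotProduct_smul, smul_eq_mul] at h1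
      have h2 : S *ᵥ M *ᵥ (x'' i t).ofLp = T *ᵥ (x'' i t).ofLp := by rw [mulVec_mulVec, hSM]
      have h3 : (v k).ofLp ⬝ᵥ S *ᵥ K *ᵥ (x i t).ofLp = σ k * ζ x t (k, i) := by
        have h4 : S *ᵥ K *ᵥ (x i t).ofLp
            = normalizedStiffness M K *ᵥ T *ᵥ (x i t).ofLp := by
          rw [normalizedStiffness, mulVec_mulVec, mulVec_mulVec, mul_assoc (_ * _), hST, mul_one]
        have hP : (normalizedStiffness M K).IsHermitian := isHermitian_mul_mul hS hK.1
        rw [h4, dotProduct_mulVec_comm_of_isHermitian hP, hPv, dotProduct_smul, smul_eq_mul,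
          dotProduct_comm]
      rw [h2, h3] at h1
      exact h1)
    k i j
  have hvec : Tendsto (fun t l => ζ x t (l, i) - ζ x t (l, j)) atTop (𝓝 0) := by
    rw [tendsto_pi_nhds]
    exact key
  have hcont : Continuous fun f : Fin n → ℝ => ‖WithLp.toLp 2 (S *ᵥ V *ᵥ f)‖ :=
    ((PiLp.continuous_toLp 2 _).comp (Continuous.matrix_mulVec continuous_const
      (Continuous.matrix_mulVec continuous_const continuous_id))).norm
  have h0 := (hcont.tendsto 0).comp hvec
  simp only [mulVec_zero, WithLp.toLp_zero, norm_zero] at h0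
  refine h0.congr fun t => ?_
  simp only [Function.comp_apply]
  congr 1
  have h5 : (fun l => ζ x t (l, i) - ζ x t (l, j))
      = (fun l => ζ x t (l, i)) - fun l => ζ x t (l, j) := rfl
  rw [h5, mulVec_sub, mulVec_sub, ← hζinv, ← hζinv]
  rfl

/-- The perturbation argument needs only g + γ in the denominator, where g = √‖G‖; the stated 2γ and
c = √(n-1) ≥ 1 are slack. -/
lemma mul_lt_of_lt_bound {g γ s m b c ε : ℝ} (hg : 0 ≤ g) (hγ : 0 < γ) (hm : 0 < m) (hb : 0 < b)
    (hc : 1 ≤ c) (hε : 0 < ε) (h : ε < γ * s * m / ((g + 2 * γ) * c * b * (m + b))) :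
    ε * b * (m + b) * (g + γ) < γ * s * m := by
  have hden : 0 < (g + 2 * γ) * c * b * (m + b) := by positivity
  refine lt_of_le_of_lt ?_ ((lt_div_iff₀ hden).1 h)
  calc ε * b * (m + b) * (g + γ) ≤ ε * b * (m + b) * ((g + 2 * γ) * c) := by
        refine mul_le_mul_of_nonneg_left ?_ (by positivity)
        have h1 : g + γ ≤ g + 2 * γ := by linarith
        exact h1.trans (le_mul_of_one_le_right (by positivity) hc)
    _ = _ := by ring

lemma exists_pos_lt_mul {x γ m : ℝ} (hγ : 0 < γ) (hm : 0 < m) : ∃ s > 0, x < γ * s * m := by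
  refine ⟨(|x| + 1) / (γ * m), by positivity, ?_⟩
  have h : γ * ((|x| + 1) / (γ * m)) * m = |x| + 1 := by field_simp
  rw [h]
  linarith [le_abs_self x]

end OscArray

theorem mainTheorem2 {q n : ℕ} (M K : Matrix (Fin n) (Fin n) ℝ)
    (D R : Fin q → Fin q → Matrix (Fin n) (Fin n) ℝ)
    (hM : M.PosDef) (hK : K.PosDef)
    (hD : ∀ i j, (D i j).PosSemidef) (hDsymm : ∀ i j, D i j = D j i) (hDdiag : ∀ i, D i i = 0)
    (hR : ∀ i j, (R i j).PosSemidef) (hRsymm : ∀ i j, R i j = R j i) (hRdiag : ∀ i, R i i = 0)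
    (hRne : ∃ i j, R i j ≠ 0)
    -- the eigenvalues of `P = M^{-1/2} K M^{-1/2}`, distinct, with unit eigenvectors
    (σ : Fin n → ℝ) (v : Fin n → EuclideanSpace ℝ (Fin n))
    (hσ : Function.Injective σ) (hv : ∀ k, ‖v k‖ = 1)
    (hPv : ∀ k, OscArray.normalizedStiffness M K *ᵥ (v k).ofLp = σ k • (v k).ofLp)
    (hlam : ∀ k, 0 < OscArray.reEigenvalue
      (OscArray.admittance (OscArray.modalBlock (OscArray.couplingLap M D) v k k)
        (OscArray.modalBlock (OscArray.couplingLap M R) v k k)) 2) :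
    (∃ r : ℝ, 0 < r ∧ ∀ ε ∈ Set.Ioo 0 r,
      OscArray.Synchronizes M K D (fun i j => ε • R i j)) ∧
    (2 ≤ n →
      0 < OscArray.couplingBound (OscArray.couplingLap M D) (OscArray.couplingLap M R) σ v ∧
      ∀ ε ∈ Set.Ioo 0
          (OscArray.couplingBound (OscArray.couplingLap M D) (OscArray.couplingLap M R) σ v),
        OscArray.Synchronizes M K D (fun i j => ε • R i j)) ∧
    (n = 1 → ∀ ε : ℝ, 0 < ε → OscArray.Synchronizes M K D (fun i j => ε • R i j)) := by
  open OscArray in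
  have hP : (normalizedStiffness M K).IsHermitian := by
    obtain ⟨T, -, hS, -, -, -⟩ := exists_sqrt hM
    exact isHermitian_mul_mul hS hK.1
  have hV : modeMatrix v * (modeMatrix v)ᵀ = 1 :=
    mul_eq_one_comm.1 (modeMatrix_orthogonal hP hσ hv hPv)
  set G := modalMatrix (couplingLap M D) v with hGdef
  set B := modalMatrix (couplingLap M R) v with hBdef
  have hG : G.PosSemidef :=
    modalMatrix_posSemidef (couplingLap_posSemidef hM hD hDsymm hDdiag) v
  have hB : B.PosSemidef :=
    modalMatrix_posSemidef (couplingLap_posSemidef hM hR hRsymm hRdiag) v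
  have hG1 := diagBlock_mulVec_one (modalMatrix_couplingLap_mulVec_eq_zero M hDdiag v)
  have hB1 := diagBlock_mulVec_one (modalMatrix_couplingLap_mulVec_eq_zero M hRdiag v)
  have hGk : ∀ k, (diagBlock G k).PosSemidef := fun k => hG.submatrix _
  have hBk : ∀ k, (diagBlock B k).IsHermitian := fun k => hB.1.submatrix _
  obtain ⟨k₀, hk₀⟩ := exists_diagBlock_ne_zero hM hR hRdiag hRne hV
  obtain ⟨hspec, hunit⟩ :=
    exists_spectrum_ne_and_unitEigenvectors_nonempty (hBk k₀) (hB1 k₀) hk₀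
  have hb : 0 < norm2 B := norm2_pos fun h => hk₀ (by
    change diagBlock B k₀ = 0
    rw [h]
    rfl)
  set m := muBar fun k => modalBlock (couplingLap M R) v k k with hmdef
  have hm : 0 < m := muBar_pos ⟨k₀, hspec⟩
  set γ := gammaBar (fun k => modalBlock (couplingLap M D) v k k)
    (fun k => modalBlock (couplingLap M R) v k k) with hγdef
  have hγ : 0 < γ := gammaBar_pos hBk ⟨k₀, hunit⟩ fun k w hw =>
    dotProduct_pos_of_mem_unitEigenvectors (hGk k) (hG1 k) (hB1 k) (hlam k) hw
  -- The separation `s` stays free: it is σ̄ for n ≥ 2, while for n = 1 there are no pairs to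
  -- separate and `s` can be taken large enough for any given ε.
  have core : ∀ s > 0, (∀ k l, k ≠ l → 2 * s ≤ |σ k - σ l|) → ∀ ε > 0,
      ε * norm2 B * (m + norm2 B) * (√(norm2 G) + γ) < γ * s * m →
      Synchronizes M K D (fun i j => ε • R i j) := by
    intro s hs hgap ε hε hsmall
    refine synchronizes_of_modal_observable hM hK hD hDsymm hDdiag hR hRsymm hRdiag hV hv hPv hε
      fun ν u hu hGu hu1 => ?_
    exact eq_zero_of_undamped_mode hB.1 hG.1 hs hm hγ hgap
      (fun k a ha b hb hab => two_mul_muBar_le _ ha hb hab) hB1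
      (fun k w β hw hw1 => gammaBar_sq_mul_norm_sq_le hGk hw hw1) hε hsmall hu hGu hu1
  have hbound : couplingBound (couplingLap M D) (couplingLap M R) σ v
      = γ * sigmaBar σ * m
        / ((√(norm2 G) + 2 * γ) * √((n : ℝ) - 1) * norm2 B * (m + norm2 B)) := rfl
  have hg := Real.sqrt_nonneg (norm2 G)
  clear_value m γ G B
  have large : 2 ≤ n →
      0 < couplingBound (couplingLap M D) (couplingLap M R) σ v ∧
      ∀ ε ∈ Set.Ioo 0 (couplingBound (couplingLap M D) (couplingLap M R) σ v),
        Synchronizes M K D (fun i j => ε • R i j) := by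
    intro hn
    have hs := sigmaBar_pos hσ hn
    have hn1 : 1 ≤ √((n : ℝ) - 1) := by
      rw [Real.one_le_sqrt]
      have : (2 : ℝ) ≤ n := by exact_mod_cast hn
      linarith
    rw [hbound]
    exact ⟨by positivity, fun ε hε => core _ hs (fun k l => two_mul_sigmaBar_le σ) ε hε.1
      (mul_lt_of_lt_bound hg hγ hm hb hn1 hε.1 hε.2)⟩
  have single : n = 1 → ∀ ε : ℝ, 0 < ε → Synchronizes M K D (fun i j => ε • R i j) := by
    rintro hn ε hε
    obtain ⟨s, hs, hlt⟩ :=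
      exists_pos_lt_mul (x := ε * norm2 B * (m + norm2 B) * (√(norm2 G) + γ)) hγ hm
    refine core s hs (fun k l h => ?_) ε hε hlt
    subst hn
    exact absurd (Subsingleton.elim k l) h
  refine ⟨?_, large, single⟩
  rcases Nat.lt_or_ge n 2 with hn | hn
  -- The case n = 0 is excluded by the index `k₀`, which comes from the nonzero R_ij.
  · have hn1 : n = 1 := by
      have := k₀.pos
      omega
    exact ⟨1, one_pos, fun ε hε => single hn1 ε hε.1⟩
  · exact ⟨_, large hn⟩
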